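/- An operator system $X$ is a nonzero closed unital self-adjoint linear subspace of a unital $C^*$-algebra, with self-adjoint part $X_{\rm sa}$; morphisms are unital completely positive (u.c.p.) maps, and $UCP_n(X)$ is the set of u.c.p. maps $X\to M_n=M_n(\mathbb C)$, $n\ge 1$. A Lip-normed operator system $(X,L)$ consists of an operator system $X$ and a real semi-norm $L$ on a dense real subspace $\mathcal D(L)\ni 1$ of $X_{\rm sa}$ such that (a) $L(a)=0$ if and only if $a\in\mathbb R1$; (b) $\rho_L(\mu,\nu)=\sup\{|\mu(a)-\nu(a)|:L(a)\le 1\}$ induces the weak$^*$ topology on the state space of the order-unit space $\mathcal D(L)$ (that is, $L$ is a Lip-norm); and (c) $\mathcal D_1(L)=\{a\in\mathcal D(L):L(a)\le 1\}$ is closed in $X_{\rm sa}$. On $UCP_n(X)$ put $\rho_{L,n}(\varphi,\psi)=\sup_{x\in\mathcal D_1(L)}\|\varphi(x)-\psi(x)\|$. The diameter $\operatorname{diam}(X,L)$ is the diameter of $UCP_n(X)$ for $\rho_{L,n}$, which does not depend on $n\geq 1$. For Lip-normed operator systems $(X,L_X)$ and $(Y,L_Y)$ let $\mathcal M(L_X,L_Y)$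 be the set of Lip-norms $L$ with domain $\mathcal D(L_X)\oplus\mathcal D(L_Y)\subseteq (X\oplus Y)_{\rm sa}$ such that $\mathcal D_1(L)$ is closed in $(X\oplus Y)_{\rm sa}$, $L_X(x)=\inf_y L(x,y)$ for all $x\in\mathcal D(L_X)$ and $L_Y(y)=\inf_x L(x,y)$ for all $y\in\mathcal D(L_Y)$. The complete distance is $$\operatorname{dist}_s(X,Y)=\inf_{L\in\mathcal M(L_X,L_Y)}\ \sup_{n\ge 1}\ \operatorname{dist}_H^{\rho_{L,n}}\big(UCP_n(X),UCP_n(Y)\big),$$ where $\operatorname{dist}_H^{\rho_{L,n}}$ is Hausdorff distance in $UCP_n(X\oplus Y)$ and $UCP_n(X)$, $UCP_n(Y)$ are embedded in it by composition with the coordinate projections. For $\epsilon>0$ let $\operatorname{Afn}_L(\epsilon)\in\mathbb N\cup\{\infty\}$ be the smallest $k$ for which there is a Lip-normed operator system $(Y,L_Y)$ with $Y$ an operator subsystem of $M_k$ and $\operatorname{dist}_s(X,Y)\le\epsilon$ ($\infty$ if there is no such $k$). Let $\mathcal R_{\rm fa}$ be the class of Lip-normed operator systems $(X,L)$ with $\operatorname{Afn}_L(\epsilon)<\infty$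 for all $\epsilon>0$. (Lip-normed operator systems are considered up to bi-Lip-isometric unital complete order isomorphism, equivalently, up to complete distance zero.) **Theorem.** Let $\mathcal C$ be a set of Lip-normed operator systems contained in $\mathcal R_{\rm fa}$. Then $\mathcal C$ is totally bounded for $\operatorname{dist}_s$ (for every $\epsilon>0$ there is a finite $\mathcal G\subseteq\mathcal C$ such that every element of $\mathcal C$ is at complete distance less than $\epsilon$ from some element of $\mathcal G$) if and only if (i) there is an $M>0$ such that $\operatorname{diam}(X,L)\le M$ for every $(X,L)\in\mathcal C$, and (ii) there is a function $F:(0,\infty)\to(0,\infty)$ such that $\operatorname{Afn}_L(\epsilon)\le F(\epsilon)$ for all $(X,L)\in\mathcal C$ and all $\epsilon>0$. -/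

import Mathlib

universe u

open Set Topology
open scoped ENNReal Matrix.Norms.L2Operator

noncomputable section

/-- Positivity in a `*`-ring. Used only for C⋆-algebras `A` and for the matrix algebras `Mₘ(A)`
over them (where the star is the conjugate transpose), in which the positive elements are exactly
those of the form `b⋆ b`. -/
def IsPos {R : Type*} [Mul R] [Star R] (a : R) : Prop := ∃ b : R, a = star b * b

/-- A (concrete, nonzero) operator system: a closed unital self-adjoint complex linear subspace of
a unital C⋆-algebra. -/
structure OperatorSystem (A : Type*) [CStarAlgebra A] where
  carrier : Submodule ℂ A
  isClosed : IsClosed (carrier : Set A)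
  one_mem : (1 : A) ∈ carrier
  star_mem : ∀ a ∈ carrier, star a ∈ carrier
  one_ne_zero : (1 : A) ≠ 0

namespace OperatorSystem

variable {A B : Type*} [CStarAlgebra A] [CStarAlgebra B]

/-- The direct sum `X ⊕ Y`, inside the C⋆-algebra `A × B` (with the maximum norm). -/
def prod (X : OperatorSystem A) (Y : OperatorSystem B) : OperatorSystem (A × B) where
  carrier := X.carrier.prod Y.carrier
  isClosed := X.isClosed.prod Y.isClosed
  one_mem := ⟨X.one_mem, Y.one_mem⟩
  star_mem := fun a ha => ⟨X.star_mem a.1 ha.1, Y.star_mem a.2 ha.2⟩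
  one_ne_zero := fun h => X.one_ne_zero (congrArg Prod.fst h)

/-- The coordinate projection `X ⊕ Y → X`. -/
def fstMap (X : OperatorSystem A) (Y : OperatorSystem B) :
    (X.prod Y).carrier →ₗ[ℂ] X.carrier where
  toFun z := ⟨(z : A × B).1, z.2.1⟩
  map_add' _ _ := rfl
  map_smul' _ _ := rfl

/-- The coordinate projection `X ⊕ Y → Y`. -/
def sndMap (X : OperatorSystem A) (Y : OperatorSystem B) :
    (X.prod Y).carrier →ₗ[ℂ] Y.carrier where
  toFun z := ⟨(z : A × B).2, z.2.2⟩
  map_add' _ _ := rfl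
  map_smul' _ _ := rfl

/-- `φ : X → Mₙ` is unital and completely positive: `φ 1 = 1`, and for all `m` the map
`Mₘ(X) → Mₘ(Mₙ)` which applies `φ` to each entry preserves positivity. -/
def IsUCP (X : OperatorSystem A) (n : ℕ)
    (φ : X.carrier →ₗ[ℂ] Matrix (Fin n) (Fin n) ℂ) : Prop :=
  φ ⟨1, X.one_mem⟩ = 1 ∧
    ∀ (m : ℕ) (x : Matrix (Fin m) (Fin m) X.carrier),
      IsPos (x.map (fun a => (a : A))) → IsPos (x.map φ)

/-- The matrix state space `UCPₙ(X)`. -/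
def UCP (X : OperatorSystem A) (n : ℕ) : Type _ :=
  {φ : X.carrier →ₗ[ℂ] Matrix (Fin n) (Fin n) ℂ // X.IsUCP n φ}

/-- The embedding `UCPₙ(X) → UCPₙ(X ⊕ Y)`, composition with the projection onto `X`. -/
def ucpFst (X : OperatorSystem A) (Y : OperatorSystem B) (n : ℕ) (φ : X.UCP n) :
    (X.prod Y).UCP n :=
  ⟨φ.1 ∘ₗ X.fstMap Y, φ.2.1, fun m x ⟨b, hb⟩ =>
    φ.2.2 m (x.map (X.fstMap Y)) ⟨b.map Prod.fst, by
      ext i j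
      have h := congrArg Prod.fst (congrFun (congrFun hb i) j)
      simpa [Matrix.mul_apply, Prod.fst_sum, fstMap] using h⟩⟩

/-- The embedding `UCPₙ(Y) → UCPₙ(X ⊕ Y)`, composition with the projection onto `Y`. -/
def ucpSnd (X : OperatorSystem A) (Y : OperatorSystem B) (n : ℕ) (ψ : Y.UCP n) :
    (X.prod Y).UCP n :=
  ⟨ψ.1 ∘ₗ X.sndMap Y, ψ.2.1, fun m x ⟨b, hb⟩ =>
    ψ.2.2 m (x.map (X.sndMap Y)) ⟨b.map Prod.snd, by
      ext i j
      have h := congrArg Prod.snd (congrFun (congrFun hb i) j)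
      simpa [Matrix.mul_apply, Prod.snd_sum, sndMap] using h⟩⟩

end OperatorSystem

/-! ### Lip-norms -/

section LipNorm

variable {A : Type*} [CStarAlgebra A]

/-- The state space of the order-unit space `D`, a real linear subspace containing `1` of the
self-adjoint part of a C⋆-algebra, with the order inherited from the C⋆-algebra. -/
def OrderUnitState (D : Submodule ℝ A) (h1 : (1 : A) ∈ D) : Type _ :=
  {μ : D →ₗ[ℝ] ℝ // μ ⟨1, h1⟩ = 1 ∧ ∀ a : D, IsPos (a : A) → 0 ≤ μ a}

/-- The weak⋆ topology on the state space, i.e. the topology of pointwise convergence on `D`. -/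
instance (D : Submodule ℝ A) (h1 : (1 : A) ∈ D) : TopologicalSpace (OrderUnitState D h1) :=
  TopologicalSpace.induced (fun μ (a : D) => μ.1 a) Pi.topologicalSpace

/-- `ρ_L(μ, ν) = sup {|μ(a) - ν(a)| : a ∈ D, L(a) ≤ 1}`, with values in `[0, ∞]`. -/
def stateDist (D : Submodule ℝ A) (h1 : (1 : A) ∈ D) (L : Seminorm ℝ D)
    (μ ν : OrderUnitState D h1) : ℝ≥0∞ :=
  ⨆ a : D, ⨆ _ : L a ≤ 1, ‖μ.1 a - ν.1 a‖ₑ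

/-- `L` is a Lip-norm on the order-unit space `D`: it vanishes exactly on the scalar multiples of
the order unit, and `ρ_L` induces the weak⋆ topology on the state space. -/
def IsLipNorm (D : Submodule ℝ A) (h1 : (1 : A) ∈ D) (L : Seminorm ℝ D) : Prop :=
  (∀ a : D, L a = 0 ↔ ∃ r : ℝ, (a : A) = r • (1 : A)) ∧
  ∀ U : Set (OrderUnitState D h1),
    IsOpen U ↔ ∀ μ ∈ U, ∃ ε : ℝ≥0∞, 0 < ε ∧ ∀ ν, stateDist D h1 L μ ν < ε → ν ∈ U

end LipNorm

/-- The Lip-norms `L` which make `(X, L)` a Lip-normed operator system: `L` is a Lip-norm on a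
dense order-unit subspace `dom` of the self-adjoint part of `X`, and `{a ∈ dom : L a ≤ 1}`
is closed. -/
structure LipNorm {A : Type*} [CStarAlgebra A] (X : OperatorSystem A) where
  dom : Submodule ℝ A
  dom_le : ∀ a ∈ dom, a ∈ X.carrier ∧ IsSelfAdjoint a
  one_mem : (1 : A) ∈ dom
  dense : ∀ x ∈ X.carrier, IsSelfAdjoint x → x ∈ closure (dom : Set A)
  L : Seminorm ℝ dom
  isLipNorm : IsLipNorm dom one_mem L
  isClosed : IsClosed {a : A | ∃ h : a ∈ dom, L ⟨a, h⟩ ≤ 1}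

namespace LipNorm

variable {A B : Type*} [CStarAlgebra A] [CStarAlgebra B]
  {X : OperatorSystem A} {Y : OperatorSystem B}

/-- `𝒟₁(L) = {a ∈ dom : L a ≤ 1}`. -/
def unitBall (LX : LipNorm X) : Set A := {a | ∃ h : a ∈ LX.dom, LX.L ⟨a, h⟩ ≤ 1}

/-- The metric `ρ_{L,n}(φ, ψ) = sup {‖φ(x) - ψ(x)‖ : x ∈ 𝒟₁(L)}` on `UCPₙ(X)`, with the
C⋆-norm (operator norm) on `Mₙ`. -/
@[reducible]
def ucpMetric (LX : LipNorm X) (n : ℕ) : PseudoEMetricSpace (X.UCP n) where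
  edist φ ψ := ⨆ x : X.carrier, ⨆ _ : (x : A) ∈ LX.unitBall, ‖φ.1 x - ψ.1 x‖ₑ
  edist_self φ := by simp
  edist_comm φ ψ := by simp only [← edist_eq_enorm_sub, edist_comm]
  edist_triangle φ ψ θ := by
    simp only [← edist_eq_enorm_sub]
    refine iSup₂_le fun x hx => (edist_triangle _ (ψ.1 x) _).trans (add_le_add ?_ ?_)
    · exact le_iSup₂ (f := fun (x : X.carrier) (_ : (x : A) ∈ LX.unitBall) =>
        edist (φ.1 x) (ψ.1 x)) x hx
    · exact le_iSup₂ (f := fun (x : X.carrier) (_ : (x : A) ∈ LX.unitBall) =>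
        edist (ψ.1 x) (θ.1 x)) x hx

/-- `diam (X, L)`, the common value of the diameters of the `UCPₙ(X)`, `n ≥ 1`. -/
def diam (LX : LipNorm X) : ℝ≥0∞ :=
  ⨆ n : ℕ, ⨆ _ : 1 ≤ n, @Metric.ediam (X.UCP n) (LX.ucpMetric n) Set.univ

/-- `ℳ(L_X, L_Y)`: the closed Lip-norms on `𝒟(L_X) ⊕ 𝒟(L_Y)` which induce `L_X` and `L_Y` via
the two quotient maps. -/
def Compatible (LX : LipNorm X) (LY : LipNorm Y) : Set (LipNorm (X.prod Y)) :=
  {N | N.dom = LX.dom.prod LY.dom ∧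
    (∀ x : LX.dom, IsGLB {r : ℝ | ∃ z : N.dom, (z : A × B).1 = x ∧ N.L z = r} (LX.L x)) ∧
    (∀ y : LY.dom, IsGLB {r : ℝ | ∃ z : N.dom, (z : A × B).2 = y ∧ N.L z = r} (LY.L y))}

/-- The Hausdorff distance between `UCPₙ(X)` and `UCPₙ(Y)` inside `UCPₙ(X ⊕ Y)`, with respect
to `ρ_{N,n}`. -/
def ucpHausdorff (N : LipNorm (X.prod Y)) (n : ℕ) : ℝ≥0∞ :=
  @Metric.hausdorffEDist ((X.prod Y).UCP n) (N.ucpMetric n)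
    (Set.range (X.ucpFst Y n)) (Set.range (X.ucpSnd Y n))

/-- The complete distance `dist_s`. -/
def completeDist (LX : LipNorm X) (LY : LipNorm Y) : ℝ≥0∞ :=
  ⨅ N ∈ LX.Compatible LY, ⨆ n : ℕ, ⨆ _ : 1 ≤ n, N.ucpHausdorff n

/-- `Afn_L(ε)`: the smallest `k` such that some Lip-normed operator subsystem of `Mₖ` is at
complete distance at most `ε` from `(X, L)`; it is `⊤` if there is no such `k`. -/
def afn (LX : LipNorm X) (ε : ℝ) : ℕ∞ :=
  sInf {m : ℕ∞ | ∃ k : ℕ, m = k ∧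
    ∃ (Y : OperatorSystem (Matrix (Fin k) (Fin k) ℂ)) (LY : LipNorm Y),
      LX.completeDist LY ≤ ENNReal.ofReal ε}

end LipNorm

/-- A Lip-normed operator system `(X, L)`. -/
structure LipNormedOperatorSystem where
  alg : Type u
  [cstar : CStarAlgebra alg]
  X : OperatorSystem alg
  L : LipNorm X

namespace LipNormedOperatorSystem

attribute [instance] LipNormedOperatorSystem.cstar

/-- The class `ℛ_fa`: the Lip-normed operator systems with `Afn_L(ε) < ∞` for all `ε > 0`. -/
def FinitelyApproximable : Set LipNormedOperatorSystem.{u} :=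
  {S | ∀ ε : ℝ, 0 < ε → S.L.afn ε < ⊤}

/-- Total boundedness for the complete distance: for all `ε > 0` there is a finite `ε`-dense
subset. -/
def IsTotallyBounded (C : Set LipNormedOperatorSystem.{u}) : Prop :=
  ∀ ε : ℝ, 0 < ε → ∃ G ⊆ C, G.Finite ∧
    ∀ S ∈ C, ∃ T ∈ G, S.L.completeDist T.L < ENNReal.ofReal ε

end LipNormedOperatorSystem

end

/-!
The argument rests on a reformulation of the elements of `ℳ(L_X, L_Y)`. By Rieffel's criterion, a
seminorm vanishing exactly on the scalars is a Lip-norm if and only if its unit ball is bounded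
modulo scalars and the bounded parts of the unit ball are totally bounded in norm
(`IsLipNorm.exists_norm_sub_le`, `IsLipNorm.totallyBounded`, `isLipNorm_of_totallyBounded`; both
directions use that the states of an order-unit space determine its norm and form a weak⋆ compact
set). On `X ⊕ Y` total boundedness is inherited from `L_X` and `L_Y`, so only boundedness modulo
scalars remains. A seminorm with this property and the two quotient conditions is called a
`LipNorm.Bridge`; its length is the supremum over `n` of the Hausdorff distances between `UCPₙ(X)`
and `UCPₙ(Y)`, and `completeDist` is the infimum of the lengths of bridges
(`LipNorm.exists_within_of_completeDist_lt`, `LipNorm.Bridge.Within.completeDist_le`). Bridges can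
be reversed and composed, which gives the symmetry and the triangle inequality of the complete
distance, and systems joined by a bridge of length at most `d` have diameters which differ by at
most `2 d` (`LipNorm.Bridge.Within.diam_le`).

If `C` is totally bounded, the diameters, which are finite (`LipNorm.exists_diam_le`), and the
approximation numbers of a finite net bound those of all elements of `C`.

Conversely, the two bounds place a Lip-normed operator subsystem `Y` of `Mₖ`, with `k` and the
diameter `R` of `Y` bounded, within a small distance of every element of `C`. The vector states
show that the unit ball of `L_Y` is, modulo scalars, contained in the ball of radius `R` of `Mₖ`
(`LipNorm.exists_norm_sub_smul_one_le`), so `Y` is described up to `δ` by a subset of a finite net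
of that ball. If `Y` and `Z` have the same description, then their unit balls are within `δ` of each
other, and `max (L_Y(y), L_Z(z), ‖y - z‖ / δ)` is a bridge. Its length is at most `δ`: by Arveson's
extension theorem (`OperatorSystem.UCP.exists_extension`, deduced from the M. Riesz extension
theorem) a u.c.p. map on `Y` extends to `Mₖ`, and its restriction to `Z` is `δ`-close to it. Hence
there are finitely many classes of elements of `C`, each of small diameter for the complete distance
(`LipNormedOperatorSystem.exists_finite_of_matrix_approx`).
-/

noncomputable section

/-! ### Positivity in C⋆-algebras -/

section Positivity

variable {A : Type*} [CStarAlgebra A]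

attribute [local instance] CStarAlgebra.spectralOrder CStarAlgebra.spectralOrderedRing

lemma isPos_iff_nonneg {a : A} : IsPos a ↔ 0 ≤ a :=
  CStarAlgebra.nonneg_iff_eq_star_mul_self.symm

lemma IsPos.isSelfAdjoint {a : A} (h : IsPos a) : IsSelfAdjoint a :=
  .of_nonneg (isPos_iff_nonneg.1 h)

lemma IsPos.add {a b : A} (ha : IsPos a) (hb : IsPos b) : IsPos (a + b) := by
  rw [isPos_iff_nonneg] at *
  exact add_nonneg ha hb

lemma IsPos.smul {a : A} (ha : IsPos a) {r : ℝ} (hr : 0 ≤ r) : IsPos (r • a) := by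
  obtain ⟨b, rfl⟩ := ha
  refine ⟨√r • b, ?_⟩
  rw [star_smul, star_trivial (√r), smul_mul_smul_comm, Real.mul_self_sqrt hr]

lemma isPos_zero : IsPos (0 : A) := isPos_iff_nonneg.2 le_rfl

lemma isPos_one : IsPos (1 : A) := ⟨1, by simp⟩

lemma isClosed_isPos : IsClosed {a : A | IsPos a} := by
  simp only [isPos_iff_nonneg]
  exact CStarAlgebra.isClosed_nonneg

lemma IsSelfAdjoint.isPos_norm_smul_one_sub {a : A} (ha : IsSelfAdjoint a) :
    IsPos (‖a‖ • (1 : A) - a) := by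
  rw [isPos_iff_nonneg, sub_nonneg, ← Algebra.algebraMap_eq_smul_one]
  exact ha.le_algebraMap_norm_self

lemma IsSelfAdjoint.isPos_norm_smul_one_add {a : A} (ha : IsSelfAdjoint a) :
    IsPos (‖a‖ • (1 : A) + a) := by
  simpa using ha.neg.isPos_norm_smul_one_sub

lemma isSelfAdjoint_smul_one (r : ℝ) : IsSelfAdjoint (r • (1 : A)) :=
  (IsSelfAdjoint.all r).smul (.one A)

/-- A self-adjoint element between `-r` and `r` has norm at most `r`. -/
lemma norm_le_of_isPos {a : A} (ha : IsSelfAdjoint a) {r : ℝ} (hr : 0 ≤ r)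
    (h₁ : IsPos (r • (1 : A) - a)) (h₂ : IsPos (r • (1 : A) + a)) : ‖a‖ ≤ r := by
  rcases subsingleton_or_nontrivial A with _ | _
  · simpa [Subsingleton.elim a 0] using hr
  rw [isPos_iff_nonneg, sub_nonneg, ← Algebra.algebraMap_eq_smul_one,
    le_algebraMap_iff_spectrum_le] at h₁
  rw [← sub_neg_eq_add, isPos_iff_nonneg, sub_nonneg, ← Algebra.algebraMap_eq_smul_one,
    le_algebraMap_iff_spectrum_le ha.neg] at h₂
  rcases CStarAlgebra.norm_or_neg_norm_mem_spectrum ha with h | h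
  · exact h₁ _ h
  · refine h₂ _ ?_
    rw [← spectrum.neg_eq]
    simpa using h

end Positivity

namespace OperatorSystem

variable {A : Type*} [CStarAlgebra A] (X : OperatorSystem A)

lemma smul_one_mem (r : ℝ) : r • (1 : A) ∈ X.carrier := by
  rw [← Complex.coe_smul]
  exact X.carrier.smul_mem _ X.one_mem

lemma real_smul_mem {a : A} (ha : a ∈ X.carrier) (r : ℝ) : r • a ∈ X.carrier := by
  rw [← Complex.coe_smul]
  exact X.carrier.smul_mem _ ha

variable {X} {n : ℕ}

lemma UCP.map_one (φ : X.UCP n) : φ.1 ⟨1, X.one_mem⟩ = 1 := φ.2.1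

lemma UCP.map_smul_one (φ : X.UCP n) (r : ℝ) :
    φ.1 ⟨r • 1, X.smul_one_mem r⟩ = r • (1 : Matrix (Fin n) (Fin n) ℂ) := by
  have : (⟨r • 1, X.smul_one_mem r⟩ : X.carrier) = (r : ℂ) • ⟨1, X.one_mem⟩ := by
    ext; simp
  rw [this, map_smul, φ.map_one, Complex.coe_smul]

/-- Complete positivity for `1 × 1` matrices is positivity. -/
lemma UCP.isPos (φ : X.UCP n) {x : X.carrier} (hx : IsPos (x : A)) : IsPos (φ.1 x) := by
  obtain ⟨b, hb⟩ := hx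
  obtain ⟨c, hc⟩ := φ.2.2 1 (Matrix.of fun _ _ => x) ⟨Matrix.of fun _ _ => b, by
    ext i j; simp [Matrix.mul_apply, hb]⟩
  refine ⟨c 0 0, ?_⟩
  have := congrFun (congrFun hc 0) 0
  simpa [Matrix.mul_apply] using this

/-- A u.c.p. map is contractive on self-adjoint elements. -/
lemma UCP.norm_le (φ : X.UCP n) {x : X.carrier} (hx : IsSelfAdjoint (x : A)) :
    ‖φ.1 x‖ ≤ ‖(x : A)‖ := by
  have h₁ := φ.isPos (x := ⟨‖(x : A)‖ • 1, X.smul_one_mem _⟩ - x) hx.isPos_norm_smul_one_sub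
  have h₂ := φ.isPos (x := ⟨‖(x : A)‖ • 1, X.smul_one_mem _⟩ + x) hx.isPos_norm_smul_one_add
  rw [map_sub, φ.map_smul_one] at h₁
  rw [map_add, φ.map_smul_one] at h₂
  refine norm_le_of_isPos ?_ (norm_nonneg _) h₁ h₂
  simpa using h₂.isSelfAdjoint.sub (isSelfAdjoint_smul_one ‖(x : A)‖)

lemma UCP.isSelfAdjoint (φ : X.UCP n) {x : X.carrier} (hx : IsSelfAdjoint (x : A)) :
    IsSelfAdjoint (φ.1 x) := by
  have h₂ := φ.isPos (x := ⟨‖(x : A)‖ • 1, X.smul_one_mem _⟩ + x) hx.isPos_norm_smul_one_add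
  rw [map_add, φ.map_smul_one] at h₂
  simpa using h₂.isSelfAdjoint.sub (isSelfAdjoint_smul_one ‖(x : A)‖)

end OperatorSystem

/-! ### States of order-unit spaces -/

namespace OrderUnitState

variable {A : Type*} [CStarAlgebra A] {D : Submodule ℝ A} {h1 : (1 : A) ∈ D}

lemma map_smul_one (μ : OrderUnitState D h1) (r : ℝ) (h : r • (1 : A) ∈ D) :
    μ.1 ⟨r • 1, h⟩ = r := by
  have : (⟨r • 1, h⟩ : D) = r • ⟨1, h1⟩ := rfl
  rw [this, map_smul, μ.2.1, smul_eq_mul, mul_one]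

lemma abs_apply_le (μ : OrderUnitState D h1) {a : D} (ha : IsSelfAdjoint (a : A)) :
    |μ.1 a| ≤ ‖a‖ := by
  have h := D.smul_mem ‖(a : A)‖ h1
  have h₁ := μ.2.2 (⟨‖(a : A)‖ • 1, h⟩ - a) ha.isPos_norm_smul_one_sub
  have h₂ := μ.2.2 (⟨‖(a : A)‖ • 1, h⟩ + a) ha.isPos_norm_smul_one_add
  rw [map_sub, map_smul_one] at h₁
  rw [map_add, map_smul_one] at h₂
  exact abs_le.2 ⟨by rw [Submodule.coe_norm]; linarith, by rw [Submodule.coe_norm]; linarith⟩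

/-- Hahn-Banach separation from the closed cone of positive elements. -/
lemma exists_lt_apply (hD : ∀ a ∈ D, IsSelfAdjoint a) {a : D} {r : ℝ}
    (h : ¬ IsPos (r • (1 : A) - a)) : ∃ μ : OrderUnitState D h1, r < μ.1 a := by
  let K : ProperCone ℝ D :=
    { carrier := {d | IsPos (d : A)}
      add_mem' := fun ha hb => ha.add hb
      zero_mem' := isPos_zero
      smul_mem' := fun c _ hx => hx.smul c.2
      isClosed' := isClosed_isPos.preimage continuous_subtype_val }
  have hb : ⟨r • 1, D.smul_mem r h1⟩ - a ∉ K := h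
  obtain ⟨f, hf, hfb⟩ := K.hyperplane_separation_point hb
  have hf1 : 0 ≤ f ⟨1, h1⟩ := hf _ (isPos_one (A := A))
  have key : ∀ d : D, -(‖(d : A)‖ * f ⟨1, h1⟩) ≤ f d := fun d => by
    have := hf (‖(d : A)‖ • ⟨1, h1⟩ + d) (hD d d.2).isPos_norm_smul_one_add
    rw [map_add, map_smul, smul_eq_mul] at this
    linarith
  -- `f` would vanish identically if it vanished at the order unit.
  have hf1' : 0 < f ⟨1, h1⟩ := by
    refine hf1.lt_of_ne fun h0 => ?_
    have := key (⟨r • 1, D.smul_mem r h1⟩ - a)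
    rw [← h0, mul_zero, neg_zero] at this
    exact absurd hfb this.not_gt
  refine ⟨⟨(f ⟨1, h1⟩)⁻¹ • f.toLinearMap, ?_, fun d hd => ?_⟩, ?_⟩
  · simp [hf1'.ne']
  · simpa using mul_nonneg (inv_nonneg.2 hf1) (hf d hd)
  · have h2 : (⟨r • 1, D.smul_mem r h1⟩ : D) = r • ⟨1, h1⟩ := rfl
    rw [h2, map_sub, map_smul, smul_eq_mul, sub_neg] at hfb
    simp only [LinearMap.smul_apply, smul_eq_mul, ContinuousLinearMap.coe_coe]
    rw [inv_mul_eq_div, lt_div_iff₀ hf1']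
    exact hfb

/-- The states of an order-unit space determine its norm. -/
lemma norm_le_of_forall (hD : ∀ a ∈ D, IsSelfAdjoint a) {a : D} {r : ℝ} (hr : 0 ≤ r)
    (h : ∀ μ : OrderUnitState D h1, |μ.1 a| ≤ r) : ‖a‖ ≤ r := by
  refine norm_le_of_isPos (hD a a.2) hr ?_ ?_
  · by_contra hn
    obtain ⟨μ, hμ⟩ := exists_lt_apply (h1 := h1) hD hn
    exact absurd ((le_abs_self _).trans (h μ)) hμ.not_ge
  · by_contra hn
    obtain ⟨μ, hμ⟩ := exists_lt_apply (h1 := h1) (a := -a) (r := r) hD (by simpa using hn)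
    rw [map_neg] at hμ
    exact absurd ((neg_le_abs _).trans (h μ)) hμ.not_ge

lemma isInducing_apply :
    IsInducing (fun (μ : OrderUnitState D h1) (a : D) => μ.1 a) := ⟨rfl⟩

lemma continuous_apply (a : D) : Continuous (fun μ : OrderUnitState D h1 => μ.1 a) :=
  (_root_.continuous_apply a).comp isInducing_apply.continuous

/-- The state space is weak⋆ compact. -/
lemma compactSpace (hD : ∀ a ∈ D, IsSelfAdjoint a) : CompactSpace (OrderUnitState D h1) := by
  refine ⟨isInducing_apply.isCompact_iff.2 ?_⟩
  have hrange : (fun (μ : OrderUnitState D h1) (a : D) => μ.1 a) '' univ =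
      {g : D → ℝ | (∀ a b, g (a + b) = g a + g b) ∧ (∀ (r : ℝ) (a), g (r • a) = r * g a) ∧
        g ⟨1, h1⟩ = 1 ∧ ∀ a : D, IsPos (a : A) → 0 ≤ g a} := by
    ext g
    constructor
    · rintro ⟨μ, -, rfl⟩
      exact ⟨μ.1.map_add, μ.1.map_smul, μ.2.1, μ.2.2⟩
    · rintro ⟨h₁, h₂, h₃, h₄⟩
      exact ⟨⟨⟨⟨g, h₁⟩, h₂⟩, h₃, h₄⟩, trivial, rfl⟩
  refine IsCompact.of_isClosed_subset
    (isCompact_univ_pi fun a : D => isCompact_Icc (a := -‖a‖) (b := ‖a‖)) ?_ ?_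
  · rw [hrange]
    simp only [ofPred_and, ofPred_forall]
    refine IsClosed.inter ?_ (IsClosed.inter ?_ (IsClosed.inter ?_ ?_))
    · exact isClosed_iInter fun a => isClosed_iInter fun b =>
        isClosed_eq (by fun_prop) (by fun_prop)
    · exact isClosed_iInter fun a => isClosed_iInter fun b =>
        isClosed_eq (by fun_prop) (by fun_prop)
    · exact isClosed_eq (by fun_prop) (by fun_prop)
    · exact isClosed_iInter fun a => isClosed_iInter fun _ =>
        isClosed_le (by fun_prop) (by fun_prop)
  · rintro _ ⟨μ, -, rfl⟩ a -
    exact abs_le.1 (μ.abs_apply_le (hD a a.2))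

/-- The convex combination `(1 - t) μ + t ν`. -/
def mix (μ ν : OrderUnitState D h1) (t : ℝ) (h0 : 0 ≤ t) (ht : t ≤ 1) : OrderUnitState D h1 :=
  ⟨(1 - t) • μ.1 + t • ν.1, by simp [μ.2.1, ν.2.1], fun a ha => by
    simpa using add_nonneg (mul_nonneg (sub_nonneg.2 ht) (μ.2.2 a ha)) (mul_nonneg h0 (ν.2.2 a ha))⟩

end OrderUnitState

section StateDist

variable {A : Type*} [CStarAlgebra A] {D : Submodule ℝ A} {h1 : (1 : A) ∈ D} {L : Seminorm ℝ D}

lemma stateDist_le_ofReal_iff {μ ν : OrderUnitState D h1} {r : ℝ} (hr : 0 ≤ r) :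
    stateDist D h1 L μ ν ≤ ENNReal.ofReal r ↔ ∀ a, L a ≤ 1 → |μ.1 a - ν.1 a| ≤ r := by
  simp only [stateDist, iSup₂_le_iff, Real.enorm_eq_ofReal_abs, ENNReal.ofReal_le_ofReal_iff hr]

lemma enorm_sub_le_stateDist (μ ν : OrderUnitState D h1) {a : D} (ha : L a ≤ 1) :
    ‖μ.1 a - ν.1 a‖ₑ ≤ stateDist D h1 L μ ν :=
  le_iSup₂ (f := fun (a : D) (_ : L a ≤ 1) => ‖μ.1 a - ν.1 a‖ₑ) a ha

lemma enorm_sub_le_mul_stateDist (μ ν : OrderUnitState D h1) (a : D) :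
    ‖μ.1 a - ν.1 a‖ₑ ≤ ENNReal.ofReal (L a + 1) * stateDist D h1 L μ ν := by
  have h0 : 0 < L a + 1 := by linarith [apply_nonneg L a]
  have h := enorm_sub_le_stateDist (L := L) μ ν (a := (L a + 1)⁻¹ • a) (by
    rw [map_smul_eq_mul, Real.norm_of_nonneg (inv_nonneg.2 h0.le), inv_mul_le_iff₀ h0]
    linarith)
  calc ‖μ.1 a - ν.1 a‖ₑ
      = ENNReal.ofReal (L a + 1) * ‖μ.1 ((L a + 1)⁻¹ • a) - ν.1 ((L a + 1)⁻¹ • a)‖ₑ := by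
        rw [map_smul, map_smul, ← smul_sub, enorm_smul, ← mul_assoc,
          ← Real.enorm_of_nonneg h0.le, ← enorm_mul, mul_inv_cancel₀ h0.ne']
        simp
    _ ≤ _ := by gcongr

lemma stateDist_triangle (μ ν θ : OrderUnitState D h1) :
    stateDist D h1 L μ θ ≤ stateDist D h1 L μ ν + stateDist D h1 L ν θ := by
  refine iSup₂_le fun a ha => ?_
  calc ‖μ.1 a - θ.1 a‖ₑ = ‖(μ.1 a - ν.1 a) + (ν.1 a - θ.1 a)‖ₑ := by rw [sub_add_sub_cancel]
    _ ≤ _ := (enorm_add_le _ _).trans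
      (add_le_add (enorm_sub_le_stateDist μ ν ha) (enorm_sub_le_stateDist ν θ ha))

lemma IsLipNorm.isOpen_ball (hL : IsLipNorm D h1 L) (μ : OrderUnitState D h1) (ε : ℝ≥0∞) :
    IsOpen {ν | stateDist D h1 L μ ν < ε} := by
  refine (hL.2 _).2 fun ν hν => ⟨ε - stateDist D h1 L μ ν, tsub_pos_of_lt hν, fun θ hθ => ?_⟩
  exact (stateDist_triangle μ ν θ).trans_lt (lt_tsub_iff_left.1 hθ)

/-- Compactness of the state space makes it totally bounded for the metric of a Lip-norm. -/
lemma IsLipNorm.exists_finset_cover (hL : IsLipNorm D h1 L) (hD : ∀ a ∈ D, IsSelfAdjoint a)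
    {ε : ℝ} (hε : 0 < ε) : ∃ T : Finset (OrderUnitState D h1), ∀ ν : OrderUnitState D h1, ∃ μ ∈ T,
      ∀ a, L a ≤ 1 → |μ.1 a - ν.1 a| ≤ ε := by
  have := OrderUnitState.compactSpace (h1 := h1) hD
  obtain ⟨T, hT⟩ := CompactSpace.elim_nhds_subcover
    (fun μ : OrderUnitState D h1 => {ν | stateDist D h1 L μ ν < ENNReal.ofReal ε}) fun μ =>
      (hL.isOpen_ball μ _).mem_nhds (by simp [stateDist, hε])
  refine ⟨T, fun ν => ?_⟩
  have hν : ν ∈ (⊤ : Set (OrderUnitState D h1)) := trivial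
  rw [← hT] at hν
  simp only [mem_iUnion] at hν
  obtain ⟨μ, hμ, h⟩ := hν
  exact ⟨μ, hμ, (stateDist_le_ofReal_iff hε.le).1 (le_of_lt h)⟩

/-- The state space has finite diameter for the metric of a Lip-norm: if it is covered by `N`
balls of radius `1`, then two of `N + 1` equidistant points of a segment lie in one ball. -/
lemma IsLipNorm.exists_abs_sub_le (hL : IsLipNorm D h1 L) (hD : ∀ a ∈ D, IsSelfAdjoint a) :
    ∃ C : ℝ, 0 ≤ C ∧ ∀ (μ ν : OrderUnitState D h1) (a : D), L a ≤ 1 → |μ.1 a - ν.1 a| ≤ C := by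
  obtain ⟨T, hT⟩ := hL.exists_finset_cover hD one_pos
  choose c hc using hT
  refine ⟨2 * (T.card + 1), by positivity, fun μ ν a ha => ?_⟩
  have hpos : (0 : ℝ) < T.card + 1 := by positivity
  have h0 : ∀ i : Fin (T.card + 1), 0 ≤ (i : ℝ) / (T.card + 1) := fun i => by positivity
  have hle : ∀ i : Fin (T.card + 1), (i : ℝ) / (T.card + 1) ≤ 1 := fun i => by
    rw [div_le_one hpos]
    exact_mod_cast i.2.le
  -- The points `θ i` divide the segment from `μ` to `ν` into steps of relative length
  -- `1 / (T.card + 1)`.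
  let θ : Fin (T.card + 1) → OrderUnitState D h1 := fun i => μ.mix ν _ (h0 i) (hle i)
  obtain ⟨i, j, hij, hcij⟩ := Fintype.exists_ne_map_eq_of_card_lt
    (fun i => (⟨c (θ i), (hc (θ i)).1⟩ : T)) (by simp)
  have hcij' : c (θ i) = c (θ j) := congrArg Subtype.val hcij
  have h₁ := (hc (θ i)).2 a ha
  have h₂ := (hc (θ j)).2 a ha
  rw [hcij'] at h₁
  have h₃ : |(θ i).1 a - (θ j).1 a| ≤ 2 := by
    rw [abs_le] at *
    constructor <;> linarith
  have h₄ : (θ i).1 a - (θ j).1 a =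
      (((j : ℤ) - (i : ℤ) : ℤ) : ℝ) * (μ.1 a - ν.1 a) / (T.card + 1) := by
    simp only [θ, OrderUnitState.mix, LinearMap.add_apply, LinearMap.smul_apply, smul_eq_mul]
    push_cast
    ring
  have h₅ : (1 : ℝ) ≤ |(((j : ℤ) - (i : ℤ) : ℤ) : ℝ)| := by
    rw [← Int.cast_abs]
    have : 1 ≤ |(j : ℤ) - (i : ℤ)| := Int.one_le_abs (by
      intro h
      exact hij (Fin.ext (by omega)))
    exact_mod_cast this
  rw [h₄, abs_div, abs_mul, abs_of_pos hpos, div_le_iff₀ hpos] at h₃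
  nlinarith [abs_nonneg (μ.1 a - ν.1 a)]

/-- The unit ball of a Lip-norm is bounded modulo scalars. -/
lemma IsLipNorm.exists_norm_sub_le (hL : IsLipNorm D h1 L) (hD : ∀ a ∈ D, IsSelfAdjoint a) :
    ∃ C : ℝ, 0 ≤ C ∧ ∀ a : D, L a ≤ 1 → ∃ t : ℝ, ‖(a : A) - t • 1‖ ≤ C := by
  obtain ⟨C, hC0, hC⟩ := hL.exists_abs_sub_le hD
  refine ⟨C, hC0, fun a ha => ?_⟩
  rcases isEmpty_or_nonempty (OrderUnitState D h1) with hE | ⟨⟨μ⟩⟩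
  · refine ⟨0, ?_⟩
    simpa using OrderUnitState.norm_le_of_forall (h1 := h1) hD hC0 (a := a) fun μ => hE.elim μ
  · refine ⟨μ.1 a, ?_⟩
    refine OrderUnitState.norm_le_of_forall (h1 := h1) hD hC0
      (a := a - ⟨μ.1 a • 1, D.smul_mem _ h1⟩) fun ν => ?_
    rw [map_sub, ν.map_smul_one]
    exact hC ν μ a ha

/-- Bounded parts of the unit ball of a Lip-norm are totally bounded in norm: an element is
determined up to `ε` by its values, up to `ε`, at an `ε`-net of the state space. -/
lemma IsLipNorm.totallyBounded (hL : IsLipNorm D h1 L) (hD : ∀ a ∈ D, IsSelfAdjoint a) (R : ℝ) :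
    TotallyBounded {a : A | ∃ h : a ∈ D, L ⟨a, h⟩ ≤ 1 ∧ ‖a‖ ≤ R} := by
  refine Metric.totallyBounded_of_finite_discretization fun ε hε => ?_
  -- One `δ` for the discretization of the values, two for replacing `ν` by a point of the net.
  obtain ⟨δ, hδ, hδε⟩ : ∃ δ : ℝ, 0 < δ ∧ 3 * δ < ε := ⟨ε / 4, by positivity, by linarith⟩
  obtain ⟨T, hT⟩ := hL.exists_finset_cover hD hδ
  refine ⟨T → Set.Icc ⌊-R / δ⌋ ⌊R / δ⌋, Fintype.ofFinite _, fun a μ => ⟨⌊μ.1.1 ⟨a, a.2.1⟩ / δ⌋, ?_⟩,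
    fun a b hab => ?_⟩
  · have := abs_le.1 ((μ.1.abs_apply_le (a := ⟨a, a.2.1⟩) (hD _ a.2.1)).trans a.2.2.2)
    exact ⟨Int.floor_le_floor (by gcongr; exact this.1),
      Int.floor_le_floor (by gcongr; exact this.2)⟩
  · rw [dist_eq_norm]
    refine (OrderUnitState.norm_le_of_forall (h1 := h1) hD (by positivity : 0 ≤ 3 * δ)
      (a := ⟨a, a.2.1⟩ - ⟨b, b.2.1⟩) fun ν => ?_).trans_lt hδε
    obtain ⟨μ, hμT, hμ⟩ := hT ν
    have h₁ := abs_le.1 (hμ _ a.2.2.1)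
    have h₂ := abs_le.1 (hμ _ b.2.2.1)
    have h₃ := Int.abs_sub_lt_one_of_floor_eq_floor
      (congrArg Subtype.val (congrFun hab ⟨μ, hμT⟩))
    rw [← sub_div, abs_div, abs_of_pos hδ, div_lt_one hδ] at h₃
    have h₄ := abs_lt.1 h₃
    rw [map_sub, abs_le]
    constructor <;> linarith [h₁.1, h₁.2, h₂.1, h₂.2, h₄.1, h₄.2]

/-- Rieffel's criterion: a seminorm which vanishes exactly on the scalars is a Lip-norm once its
unit ball is bounded modulo scalars and the bounded parts of the unit ball are totally bounded. -/
lemma isLipNorm_of_totallyBounded (hD : ∀ a ∈ D, IsSelfAdjoint a)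
    (h0 : ∀ a : D, L a = 0 ↔ ∃ r : ℝ, (a : A) = r • (1 : A)) {C : ℝ}
    (hC : ∀ a : D, L a ≤ 1 → ∃ t : ℝ, ‖(a : A) - t • 1‖ ≤ C)
    (hT : TotallyBounded {a : A | ∃ h : a ∈ D, L ⟨a, h⟩ ≤ 1 ∧ ‖a‖ ≤ C}) :
    IsLipNorm D h1 L := by
  have hnhds : ∀ μ : OrderUnitState D h1, 𝓝 μ = Filter.comap (stateDist D h1 L μ) (𝓝 0) := by
    intro μ
    apply le_antisymm
    -- A ball for `ρ_L` contains the weak⋆ neighbourhood of states which are close to `μ` on a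
    -- finite net of the bounded part of the unit ball.
    · rw [← Filter.map_le_iff_le_comap, ENNReal.nhds_zero_basis.ge_iff]
      intro ε hε
      obtain ⟨e, he, heε⟩ : ∃ e : ℝ, 0 < e ∧ ENNReal.ofReal e < ε := by
        obtain ⟨q, -, hq0, hq⟩ := ENNReal.lt_iff_exists_real_btwn.1 hε
        exact ⟨q, by simpa using hq0, hq⟩
      obtain ⟨F, hFs, hF, hcov⟩ := Metric.finite_approx_of_totallyBounded hT (e / 3) (by positivity)
      have hev : ∀ᶠ ν in 𝓝 μ, ∀ f ∈ F, ∀ h : f ∈ D, |μ.1 ⟨f, h⟩ - ν.1 ⟨f, h⟩| < e / 3 := by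
        refine (Filter.eventually_all_finite hF).2 fun f hf => ?_
        have hfD := (hFs hf).1
        have hc : Filter.Tendsto (fun ν : OrderUnitState D h1 => |μ.1 ⟨f, hfD⟩ - ν.1 ⟨f, hfD⟩|)
            (𝓝 μ) (𝓝 |μ.1 ⟨f, hfD⟩ - μ.1 ⟨f, hfD⟩|) :=
          (continuous_abs.comp
            (continuous_const.sub (OrderUnitState.continuous_apply ⟨f, hfD⟩))).tendsto μ
        rw [sub_self, abs_zero] at hc
        filter_upwards [hc.eventually_lt_const (show 0 < e / 3 by positivity)] with ν hν _
        exact hν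
      change _ ∈ 𝓝 μ
      filter_upwards [hev] with ν hν
      refine lt_of_le_of_lt ((stateDist_le_ofReal_iff he.le).2 fun a ha => ?_) heε
      obtain ⟨t, ht⟩ := hC a ha
      have htD := D.smul_mem t h1
      have hb : (a : A) - t • 1 ∈ {a : A | ∃ h : a ∈ D, L ⟨a, h⟩ ≤ 1 ∧ ‖a‖ ≤ C} := by
        refine ⟨D.sub_mem a.2 htD, ?_, ht⟩
        have hz : L ⟨t • 1, htD⟩ = 0 := (h0 _).2 ⟨t, rfl⟩
        have := map_sub_le_add L a ⟨t • 1, htD⟩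
        exact this.trans (by linarith)
      obtain ⟨f, hf, hfb⟩ := mem_iUnion₂.1 (hcov hb)
      have hfD := (hFs hf).1
      rw [Metric.mem_ball, dist_eq_norm] at hfb
      have key : ∀ θ : OrderUnitState D h1, |θ.1 a - t - θ.1 ⟨f, hfD⟩| ≤ e / 3 := fun θ => by
        have := θ.abs_apply_le (a := a - ⟨t • 1, htD⟩ - ⟨f, hfD⟩)
          (hD _ (a - ⟨t • 1, htD⟩ - ⟨f, hfD⟩).2)
        rw [map_sub, map_sub, θ.map_smul_one] at this
        exact this.trans hfb.le
      have h₁ := abs_le.1 (key μ)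
      have h₂ := abs_le.1 (key ν)
      have h₃ := abs_lt.1 (hν f hf hfD)
      rw [abs_le]
      constructor <;> linarith [h₁.1, h₁.2, h₂.1, h₂.2, h₃.1, h₃.2]
    -- Evaluation at `a` is continuous for `ρ_L`, with Lipschitz constant at most `L a + 1`.
    · rw [OrderUnitState.isInducing_apply.nhds_eq_comap, ← Filter.tendsto_iff_comap,
        tendsto_pi_nhds]
      intro a
      rw [tendsto_iff_edist_tendsto_0]
      have h₁ : Filter.Tendsto (fun ν => ENNReal.ofReal (L a + 1) * stateDist D h1 L μ ν)
          (Filter.comap (stateDist D h1 L μ) (𝓝 0)) (𝓝 0) := by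
        simpa using ENNReal.Tendsto.const_mul (a := ENNReal.ofReal (L a + 1))
          (Filter.tendsto_comap (f := stateDist D h1 L μ) (x := 𝓝 0)) (Or.inr ENNReal.ofReal_ne_top)
      refine tendsto_of_tendsto_of_tendsto_of_le_of_le tendsto_const_nhds h₁ (fun _ => zero_le)
        fun ν => ?_
      rw [edist_comm, edist_eq_enorm_sub]
      exact enorm_sub_le_mul_stateDist μ ν a
  refine ⟨h0, fun U => ?_⟩
  rw [isOpen_iff_mem_nhds]
  refine forall₂_congr fun μ _ => ?_
  rw [hnhds, (ENNReal.nhds_zero_basis.comap _).mem_iff]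
  rfl

end StateDist

/-! ### Bridges between Lip-normed operator systems -/

lemma le_mul_of_forall_gt {v K a : ℝ} (hK : 0 ≤ K) (h : ∀ s, a < s → v ≤ K * s) : v ≤ K * a := by
  refine le_of_forall_pos_le_add fun ε hε => ?_
  have hK' : 0 < K + 1 := by linarith
  refine (h (a + ε / (K + 1)) (by simpa using div_pos hε hK')).trans ?_
  rw [mul_add, mul_div_assoc']
  gcongr
  rw [div_le_iff₀ hK']
  linarith

lemma Seminorm.le_mul_of_forall_le_one {E : Type*} [AddCommGroup E] [Module ℝ E]
    {p q : Seminorm ℝ E} {d : ℝ} (hd : 0 ≤ d) (h : ∀ z, p z ≤ 1 → q z ≤ d) (z : E) :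
    q z ≤ d * p z := by
  refine le_mul_of_forall_gt hd fun s hs => ?_
  have hs0 : 0 < s := (apply_nonneg p z).trans_lt hs
  have := h (s⁻¹ • z) (by
    rw [map_smul_eq_mul, Real.norm_of_nonneg (inv_nonneg.2 hs0.le), inv_mul_le_iff₀ hs0]
    linarith)
  rwa [map_smul_eq_mul, Real.norm_of_nonneg (inv_nonneg.2 hs0.le), inv_mul_le_iff₀ hs0,
    mul_comm] at this

lemma totallyBounded_prod {E F : Type*} [UniformSpace E] [UniformSpace F] [CompleteSpace E]
    [CompleteSpace F] {s : Set E} {t : Set F} (hs : TotallyBounded s) (ht : TotallyBounded t) :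
    TotallyBounded (s ×ˢ t) :=
  ((hs.closure.isCompact_of_isClosed isClosed_closure).prod
    (ht.closure.isCompact_of_isClosed isClosed_closure)).totallyBounded.subset
      (prod_mono subset_closure subset_closure)

lemma norm_sub_mul_smul_le {E : Type*} [NormedAddCommGroup E] [NormedSpace ℝ E] {a e : E}
    {s t R : ℝ} (hs : 0 < s) (h : ‖s⁻¹ • a - t • e‖ ≤ R) : ‖a - (s * t) • e‖ ≤ s * R := by
  have key : a - (s * t) • e = s • (s⁻¹ • a - t • e) := by
    rw [smul_sub, smul_inv_smul₀ hs.ne', smul_smul]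
  rw [key, norm_smul, Real.norm_of_nonneg hs.le]
  gcongr

lemma OperatorSystem.norm_smul_one {A : Type*} [CStarAlgebra A] (X : OperatorSystem A) (t : ℝ) :
    ‖t • (1 : A)‖ = |t| := by
  have : Nontrivial A := ⟨1, 0, X.one_ne_zero⟩
  rw [norm_smul, CStarRing.norm_one, mul_one, Real.norm_eq_abs]

namespace LipNorm

variable {A B C : Type*} [CStarAlgebra A] [CStarAlgebra B] [CStarAlgebra C]
  {X : OperatorSystem A} {Y : OperatorSystem B} {Z : OperatorSystem C}

lemma mem_carrier (LX : LipNorm X) (x : LX.dom) : (x : A) ∈ X.carrier := (LX.dom_le x x.2).1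

lemma isSelfAdjoint (LX : LipNorm X) : ∀ a ∈ LX.dom, IsSelfAdjoint a := fun a ha =>
  (LX.dom_le a ha).2

lemma smul_one_mem (LX : LipNorm X) (t : ℝ) : t • (1 : A) ∈ LX.dom :=
  LX.dom.smul_mem t LX.one_mem

lemma L_smul_one (LX : LipNorm X) (t : ℝ) : LX.L ⟨t • 1, LX.smul_one_mem t⟩ = 0 :=
  (LX.isLipNorm.1 _).2 ⟨t, rfl⟩

/-- Adding a scalar does not increase the Lip-norm. -/
lemma exists_eq_add_smul_one (LX : LipNorm X) (x : LX.dom) (t : ℝ) :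
    ∃ y : LX.dom, (y : A) = x + t • (1 : A) ∧ LX.L y ≤ LX.L x :=
  ⟨x + ⟨t • 1, LX.smul_one_mem t⟩, rfl, by
    simpa [LX.L_smul_one] using map_add_le_add LX.L x ⟨t • 1, LX.smul_one_mem t⟩⟩

/-- A bridge between `(X, L_X)` and `(Y, L_Y)`: the data of an element of `ℳ(L_X, L_Y)`, as a
seminorm on the product of the two domains, with the requirement on the weak⋆ topology replaced by
boundedness of the unit ball modulo scalars. -/
structure Bridge (LX : LipNorm X) (LY : LipNorm Y) where
  p : Seminorm ℝ (LX.dom × LY.dom)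
  map_one : p (⟨1, LX.one_mem⟩, ⟨1, LY.one_mem⟩) = 0
  le_left : ∀ x y, LX.L x ≤ p (x, y)
  le_right : ∀ x y, LY.L y ≤ p (x, y)
  exists_left : ∀ x r, LX.L x < r → ∃ y, p (x, y) < r
  exists_right : ∀ y r, LY.L y < r → ∃ x, p (x, y) < r
  bounded : ∃ R : ℝ, 0 ≤ R ∧ ∀ x y, p (x, y) ≤ 1 →
    ∃ t : ℝ, ‖(x : A) - t • 1‖ ≤ R ∧ ‖(y : B) - t • 1‖ ≤ R
  isClosed : IsClosed {z : A × B | ∃ (h₁ : z.1 ∈ LX.dom) (h₂ : z.2 ∈ LY.dom),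
    p (⟨z.1, h₁⟩, ⟨z.2, h₂⟩) ≤ 1}

namespace Bridge

variable {LX : LipNorm X} {LY : LipNorm Y} {LZ : LipNorm Z}

lemma bounded_scaled (P : Bridge LX LY) : ∃ R : ℝ, 0 ≤ R ∧ ∀ s : ℝ, 0 < s → ∀ x y, P.p (x, y) ≤ s →
    ∃ t : ℝ, ‖(x : A) - t • 1‖ ≤ s * R ∧ ‖(y : B) - t • 1‖ ≤ s * R := by
  obtain ⟨R, hR0, hR⟩ := P.bounded
  refine ⟨R, hR0, fun s hs x y hxy => ?_⟩
  obtain ⟨t, h₁, h₂⟩ := hR (s⁻¹ • x) (s⁻¹ • y) (by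
    rw [← Prod.smul_mk, map_smul_eq_mul, Real.norm_of_nonneg (inv_nonneg.2 hs.le),
      inv_mul_le_iff₀ hs]
    linarith)
  exact ⟨s * t, norm_sub_mul_smul_le hs h₁, norm_sub_mul_smul_le hs h₂⟩

/-- The identification of `𝒟(L_X) ⊕ 𝒟(L_Y)`, inside `A × B`, with the product of the domains. -/
def domProd (LX : LipNorm X) (LY : LipNorm Y) :
    LX.dom.prod LY.dom →ₗ[ℝ] LX.dom × LY.dom where
  toFun z := (⟨(z : A × B).1, z.2.1⟩, ⟨(z : A × B).2, z.2.2⟩)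
  map_add' _ _ := rfl
  map_smul' _ _ := rfl

/-- A bridge vanishes only on scalars: if it vanishes at `(r, s)`, then it vanishes at all multiples
of `(r, s)`, and boundedness modulo scalars forces `r = s`. -/
lemma exists_eq_smul_one (P : Bridge LX LY) {x : LX.dom} {y : LY.dom} (h : P.p (x, y) = 0) :
    ∃ r : ℝ, (x : A) = r • 1 ∧ (y : B) = r • 1 := by
  obtain ⟨r, hr⟩ := (LX.isLipNorm.1 x).1
    (le_antisymm ((P.le_left x y).trans h.le) (apply_nonneg _ _))
  obtain ⟨s, hs⟩ := (LY.isLipNorm.1 y).1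
    (le_antisymm ((P.le_right x y).trans h.le) (apply_nonneg _ _))
  obtain ⟨R, hR0, hR⟩ := P.bounded
  suffices r = s by exact ⟨r, hr, this ▸ hs⟩
  by_contra hne
  have hpos : 0 < |r - s| := abs_pos.2 (sub_ne_zero.2 hne)
  obtain ⟨n, hn⟩ := exists_nat_gt (2 * R / |r - s|)
  obtain ⟨t, h₁, h₂⟩ := hR ((n : ℝ) • x) ((n : ℝ) • y) (by
    rw [← Prod.smul_mk, map_smul_eq_mul, h, mul_zero]; exact zero_le_one)
  rw [Submodule.coe_smul, hr, smul_smul, ← sub_smul, X.norm_smul_one] at h₁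
  rw [Submodule.coe_smul, hs, smul_smul, ← sub_smul, Y.norm_smul_one] at h₂
  rw [div_lt_iff₀ hpos, ← Nat.abs_cast n, ← abs_mul] at hn
  have : |(n : ℝ) * (r - s)| ≤ 2 * R := by
    rw [abs_le] at *
    constructor <;> linarith [h₁.1, h₁.2, h₂.1, h₂.2]
  exact this.not_gt hn

/-- The Lip-norm on `X ⊕ Y` defined by a bridge. -/
def toLipNorm (P : Bridge LX LY) : LipNorm (X.prod Y) where
  dom := LX.dom.prod LY.dom
  dom_le a ha := ⟨⟨(LX.dom_le _ ha.1).1, (LY.dom_le _ ha.2).1⟩,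
    Prod.ext (LX.dom_le _ ha.1).2 (LY.dom_le _ ha.2).2⟩
  one_mem := ⟨LX.one_mem, LY.one_mem⟩
  dense x hx hsa := by
    rw [Submodule.prod_coe, closure_prod_eq]
    exact ⟨LX.dense _ hx.1 (congrArg Prod.fst hsa), LY.dense _ hx.2 (congrArg Prod.snd hsa)⟩
  L := P.p.comp (domProd LX LY)
  isLipNorm := by
    obtain ⟨R, hR0, hR⟩ := P.bounded
    refine isLipNorm_of_totallyBounded (C := R)
      (fun a ha => Prod.ext (LX.dom_le _ ha.1).2 (LY.dom_le _ ha.2).2) (fun a => ⟨fun h => ?_, ?_⟩)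
      (fun a ha => ?_) ?_
    · obtain ⟨r, h₁, h₂⟩ := P.exists_eq_smul_one h
      exact ⟨r, Prod.ext h₁ h₂⟩
    · rintro ⟨r, hr⟩
      have h₁ : domProd LX LY a = r • (⟨1, LX.one_mem⟩, ⟨1, LY.one_mem⟩) :=
        Prod.ext (Subtype.ext (congrArg Prod.fst hr)) (Subtype.ext (congrArg Prod.snd hr))
      rw [Seminorm.comp_apply, h₁, map_smul_eq_mul, P.map_one, mul_zero]
    · obtain ⟨t, h₁, h₂⟩ := hR _ _ ha
      exact ⟨t, norm_prod_le_iff.2 ⟨h₁, h₂⟩⟩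
    · refine TotallyBounded.subset ?_
        (totallyBounded_prod (LX.isLipNorm.totallyBounded LX.isSelfAdjoint R)
          (LY.isLipNorm.totallyBounded LY.isSelfAdjoint R))
      rintro ⟨x, y⟩ ⟨⟨hx, hy⟩, h₁, h₂⟩
      have h₃ := norm_prod_le_iff.1 h₂
      exact ⟨⟨hx, (P.le_left _ ⟨y, hy⟩).trans h₁, h₃.1⟩,
        ⟨hy, (P.le_right ⟨x, hx⟩ _).trans h₁, h₃.2⟩⟩
  isClosed := by
    have : {z : A × B | ∃ h : z ∈ LX.dom.prod LY.dom, P.p.comp (domProd LX LY) ⟨z, h⟩ ≤ 1} =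
        {z : A × B | ∃ (h₁ : z.1 ∈ LX.dom) (h₂ : z.2 ∈ LY.dom),
          P.p (⟨z.1, h₁⟩, ⟨z.2, h₂⟩) ≤ 1} := by
      ext z
      exact ⟨fun ⟨h, hz⟩ => ⟨h.1, h.2, hz⟩, fun ⟨h₁, h₂, hz⟩ => ⟨⟨h₁, h₂⟩, hz⟩⟩
    rw [this]
    exact P.isClosed

lemma toLipNorm_mem (P : Bridge LX LY) : P.toLipNorm ∈ LX.Compatible LY := by
  refine ⟨rfl, fun x => ⟨?_, fun b hb => ?_⟩, fun y => ⟨?_, fun b hb => ?_⟩⟩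
  · rintro _ ⟨z, hz, rfl⟩
    have : (domProd LX LY z).1 = x := Subtype.ext hz
    exact this ▸ P.le_left _ _
  · refine le_of_forall_gt_imp_ge_of_dense fun r hr => ?_
    obtain ⟨y, hy⟩ := P.exists_left x r hr
    exact (hb ⟨⟨(x, y), x.2, y.2⟩, rfl, rfl⟩).trans hy.le
  · rintro _ ⟨z, hz, rfl⟩
    have : (domProd LX LY z).2 = y := Subtype.ext hz
    exact this ▸ P.le_right _ _
  · refine le_of_forall_gt_imp_ge_of_dense fun r hr => ?_
    obtain ⟨x, hx⟩ := P.exists_right y r hr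
    exact (hb ⟨⟨(x, y), x.2, y.2⟩, rfl, rfl⟩).trans hx.le

/-- The identification of the product of the domains with the domain of `N ∈ ℳ(L_X, L_Y)`. -/
def pairMap {N : LipNorm (X.prod Y)} (hN : N ∈ LX.Compatible LY) :
    LX.dom × LY.dom →ₗ[ℝ] N.dom where
  toFun z := ⟨((z.1 : A), (z.2 : B)), hN.1.symm ▸ ⟨z.1.2, z.2.2⟩⟩
  map_add' _ _ := rfl
  map_smul' _ _ := rfl

/-- The bridge defined by an element of `ℳ(L_X, L_Y)`. -/
def ofCompatible {N : LipNorm (X.prod Y)} (hN : N ∈ LX.Compatible LY) : Bridge LX LY where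
  p := N.L.comp (pairMap hN)
  map_one := (N.isLipNorm.1 _).2 ⟨1, (one_smul _ _).symm⟩
  le_left x y := (hN.2.1 x).1 ⟨_, rfl, rfl⟩
  le_right x y := (hN.2.2 y).1 ⟨_, rfl, rfl⟩
  exists_left x r hr := by
    obtain ⟨_, ⟨z, hz, rfl⟩, -, hzr⟩ := (hN.2.1 x).exists_between hr
    have hz' : (z : A × B) ∈ LX.dom.prod LY.dom := by rw [← hN.1]; exact z.2
    refine ⟨⟨(z : A × B).2, hz'.2⟩, lt_of_eq_of_lt ?_ hzr⟩
    exact congrArg N.L (Subtype.ext (Prod.ext hz.symm rfl))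
  exists_right y r hr := by
    obtain ⟨_, ⟨z, hz, rfl⟩, -, hzr⟩ := (hN.2.2 y).exists_between hr
    have hz' : (z : A × B) ∈ LX.dom.prod LY.dom := by rw [← hN.1]; exact z.2
    refine ⟨⟨(z : A × B).1, hz'.1⟩, lt_of_eq_of_lt ?_ hzr⟩
    exact congrArg N.L (Subtype.ext (Prod.ext rfl hz.symm))
  bounded := by
    obtain ⟨R, hR0, hR⟩ := N.isLipNorm.exists_norm_sub_le N.isSelfAdjoint
    refine ⟨R, hR0, fun x y hxy => ?_⟩
    obtain ⟨t, ht⟩ := hR _ hxy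
    exact ⟨t, norm_prod_le_iff.1 ht⟩
  isClosed := by
    have : {z : A × B | ∃ (h₁ : z.1 ∈ LX.dom) (h₂ : z.2 ∈ LY.dom),
        N.L.comp (pairMap hN) (⟨z.1, h₁⟩, ⟨z.2, h₂⟩) ≤ 1} =
        {z : A × B | ∃ h : z ∈ N.dom, N.L ⟨z, h⟩ ≤ 1} := by
      ext z
      constructor
      · rintro ⟨h₁, h₂, hz⟩
        exact ⟨_, hz⟩
      · rintro ⟨h, hz⟩
        have hz' : (z : A × B) ∈ LX.dom.prod LY.dom := by rw [← hN.1]; exact h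
        exact ⟨hz'.1, hz'.2, hz⟩
    rw [this]
    exact N.isClosed

/-- `P.Within d`: for every `n ≥ 1` the sets `UCPₙ(X)` and `UCPₙ(Y)` lie in the closed
`d`-neighbourhoods of each other, for the metric of the Lip-norm defined by `P`. -/
def Within (P : Bridge LX LY) (d : ℝ) : Prop :=
  ∀ n : ℕ, 1 ≤ n →
    (∀ φ : X.UCP n, ∃ ψ : Y.UCP n, ∀ (x : LX.dom) (y : LY.dom),
      ‖φ.1 ⟨x, LX.mem_carrier x⟩ - ψ.1 ⟨y, LY.mem_carrier y⟩‖ ≤ d * P.p (x, y)) ∧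
    (∀ ψ : Y.UCP n, ∃ φ : X.UCP n, ∀ (x : LX.dom) (y : LY.dom),
      ‖φ.1 ⟨x, LX.mem_carrier x⟩ - ψ.1 ⟨y, LY.mem_carrier y⟩‖ ≤ d * P.p (x, y))

/-- The seminorm `(x, y) ↦ ‖φ(x) - ψ(y)‖`. -/
def ucpSeminorm (LX : LipNorm X) (LY : LipNorm Y) {n : ℕ} (φ : X.UCP n) (ψ : Y.UCP n) :
    Seminorm ℝ (LX.dom × LY.dom) :=
  (normSeminorm ℝ (Matrix (Fin n) (Fin n) ℂ)).comp
    { toFun := fun z => φ.1 ⟨z.1, LX.mem_carrier z.1⟩ - ψ.1 ⟨z.2, LY.mem_carrier z.2⟩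
      map_add' := fun a b => by
        have h₁ := φ.1.map_add ⟨a.1, LX.mem_carrier a.1⟩ ⟨b.1, LX.mem_carrier b.1⟩
        have h₂ := ψ.1.map_add ⟨a.2, LY.mem_carrier a.2⟩ ⟨b.2, LY.mem_carrier b.2⟩
        rw [sub_add_sub_comm, ← h₁, ← h₂]
        rfl
      map_smul' := fun r a => by
        have h₁ := φ.1.map_smul (r : ℂ) ⟨a.1, LX.mem_carrier a.1⟩
        have h₂ := ψ.1.map_smul (r : ℂ) ⟨a.2, LY.mem_carrier a.2⟩
        rw [RingHom.id_apply, smul_sub, ← Complex.coe_smul, ← Complex.coe_smul, ← h₁, ← h₂]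
        rfl }

lemma edist_le_iff {N : LipNorm (X.prod Y)} (hN : N ∈ LX.Compatible LY) {n : ℕ} (φ : X.UCP n)
    (ψ : Y.UCP n) {d : ℝ} (hd : 0 ≤ d) :
    (N.ucpMetric n).edist (X.ucpFst Y n φ) (X.ucpSnd Y n ψ) ≤ ENNReal.ofReal d ↔
      ∀ (x : LX.dom) (y : LY.dom),
        ‖φ.1 ⟨x, LX.mem_carrier x⟩ - ψ.1 ⟨y, LY.mem_carrier y⟩‖ ≤
          d * (ofCompatible hN).p (x, y) := by
  refine (iSup₂_le_iff).trans ⟨fun h x y => ?_, fun h z hz => ?_⟩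
  · refine Seminorm.le_mul_of_forall_le_one (p := (ofCompatible hN).p) (q := ucpSeminorm LX LY φ ψ)
      hd (fun z hz => ?_) (x, y)
    have := h ⟨(z.1, z.2), LX.mem_carrier z.1, LY.mem_carrier z.2⟩ ⟨_, hz⟩
    rw [← ofReal_norm, ENNReal.ofReal_le_ofReal_iff hd] at this
    exact this
  · obtain ⟨h₁, h₂⟩ := hz
    have hz' : (z : A × B) ∈ LX.dom.prod LY.dom := by rw [← hN.1]; exact h₁
    rw [← ofReal_norm, ENNReal.ofReal_le_ofReal_iff hd]
    exact (h ⟨_, hz'.1⟩ ⟨_, hz'.2⟩).trans (mul_le_of_le_one_right hd h₂)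

end Bridge

variable {LX : LipNorm X} {LY : LipNorm Y} {LZ : LipNorm Z}

lemma exists_within_of_completeDist_lt {d : ℝ} (h : LX.completeDist LY < ENNReal.ofReal d) :
    ∃ P : Bridge LX LY, P.Within d := by
  have hd : 0 ≤ d := (ENNReal.ofReal_pos.1 (bot_le.trans_lt h)).le
  obtain ⟨N, hN⟩ := iInf_lt_iff.1 h
  obtain ⟨hN, hlt⟩ := iInf_lt_iff.1 hN
  refine ⟨Bridge.ofCompatible hN, fun n hn => ?_⟩
  have hH : N.ucpHausdorff n < ENNReal.ofReal d :=
    (le_iSup₂ (f := fun (n : ℕ) (_ : 1 ≤ n) => N.ucpHausdorff n) n hn).trans_lt hlt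
  let := N.ucpMetric n
  constructor
  · intro φ
    obtain ⟨_, ⟨ψ, rfl⟩, hψ⟩ := Metric.exists_edist_lt_of_hausdorffEDist_lt (mem_range_self φ) hH
    exact ⟨ψ, (Bridge.edist_le_iff hN φ ψ hd).1 hψ.le⟩
  · intro ψ
    rw [ucpHausdorff, Metric.hausdorffEDist_comm] at hH
    obtain ⟨_, ⟨φ, rfl⟩, hφ⟩ := Metric.exists_edist_lt_of_hausdorffEDist_lt (mem_range_self ψ) hH
    rw [edist_comm] at hφ
    exact ⟨φ, (Bridge.edist_le_iff hN φ ψ hd).1 hφ.le⟩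

lemma Bridge.Within.completeDist_le {P : Bridge LX LY} {d : ℝ} (hd : 0 ≤ d) (h : P.Within d) :
    LX.completeDist LY ≤ ENNReal.ofReal d := by
  refine (iInf₂_le P.toLipNorm P.toLipNorm_mem).trans (iSup₂_le fun n hn => ?_)
  let := P.toLipNorm.ucpMetric n
  refine Metric.hausdorffEDist_le_of_mem_edist ?_ ?_
  · rintro _ ⟨φ, rfl⟩
    obtain ⟨ψ, hψ⟩ := (h n hn).1 φ
    exact ⟨_, ⟨ψ, rfl⟩, (Bridge.edist_le_iff P.toLipNorm_mem φ ψ hd).2 hψ⟩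
  · rintro _ ⟨ψ, rfl⟩
    obtain ⟨φ, hφ⟩ := (h n hn).2 ψ
    refine ⟨_, ⟨φ, rfl⟩, ?_⟩
    rw [edist_comm]
    exact (Bridge.edist_le_iff P.toLipNorm_mem φ ψ hd).2 hφ

end LipNorm

/-! ### Symmetry and the triangle inequality for bridges -/

namespace LipNorm

variable {A B C : Type*} [CStarAlgebra A] [CStarAlgebra B] [CStarAlgebra C]
  {X : OperatorSystem A} {Y : OperatorSystem B} {Z : OperatorSystem C}
  {LX : LipNorm X} {LY : LipNorm Y} {LZ : LipNorm Z}

namespace Bridge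

/-- The same bridge, read from `Y` to `X`. -/
def symm (P : Bridge LX LY) : Bridge LY LX where
  p := P.p.comp (LinearEquiv.prodComm ℝ LY.dom LX.dom).toLinearMap
  map_one := P.map_one
  le_left y x := P.le_right x y
  le_right y x := P.le_left x y
  exists_left := P.exists_right
  exists_right := P.exists_left
  bounded := by
    obtain ⟨R, hR0, hR⟩ := P.bounded
    refine ⟨R, hR0, fun y x h => ?_⟩
    obtain ⟨t, h₁, h₂⟩ := hR x y h
    exact ⟨t, h₂, h₁⟩
  isClosed := by
    convert! P.isClosed.preimage (continuous_swap (X := B) (Y := A)) using 1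
    ext z
    exact ⟨fun ⟨h₁, h₂, h⟩ => ⟨h₂, h₁, h⟩, fun ⟨h₁, h₂, h⟩ => ⟨h₂, h₁, h⟩⟩

lemma Within.symm {P : Bridge LX LY} {d : ℝ} (h : P.Within d) : P.symm.Within d := by
  refine fun n hn => ⟨fun ψ => ?_, fun φ => ?_⟩
  · obtain ⟨φ, hφ⟩ := (h n hn).2 ψ
    exact ⟨φ, fun y x => by rw [norm_sub_rev]; exact hφ x y⟩
  · obtain ⟨ψ, hψ⟩ := (h n hn).1 φ
    exact ⟨ψ, fun y x => by rw [norm_sub_rev]; exact hψ x y⟩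

lemma bddBelow_max (P : Bridge LX LY) (Q : Bridge LY LZ) (x : LX.dom) (z : LZ.dom) :
    BddBelow (range fun y : LY.dom => max (P.p (x, y)) (Q.p (y, z))) :=
  ⟨0, by rintro _ ⟨y, rfl⟩; exact le_max_of_le_left (apply_nonneg _ _)⟩

/-- The seminorm `(x, z) ↦ inf_y max (p(x, y), q(y, z))`. -/
def compSeminorm (P : Bridge LX LY) (Q : Bridge LY LZ) : Seminorm ℝ (LX.dom × LZ.dom) :=
  Seminorm.ofSMulLE (fun w => ⨅ y : LY.dom, max (P.p (w.1, y)) (Q.p (y, w.2)))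
    (le_antisymm ((ciInf_le (bddBelow_max P Q 0 0) 0).trans (by simp [Prod.mk_zero_zero]))
      (le_ciInf fun y => le_max_of_le_left (apply_nonneg _ _)))
    (fun v w => by
      refine le_of_forall_pos_le_add fun ε hε => ?_
      obtain ⟨y₁, h₁⟩ := exists_lt_of_ciInf_lt (lt_add_of_pos_right
        (⨅ y : LY.dom, max (P.p (v.1, y)) (Q.p (y, v.2))) (half_pos hε))
      obtain ⟨y₂, h₂⟩ := exists_lt_of_ciInf_lt (lt_add_of_pos_right
        (⨅ y : LY.dom, max (P.p (w.1, y)) (Q.p (y, w.2))) (half_pos hε))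
      refine (ciInf_le (bddBelow_max P Q _ _) (y₁ + y₂)).trans ?_
      have h₃ := map_add_le_add P.p (v.1, y₁) (w.1, y₂)
      have h₄ := map_add_le_add Q.p (y₁, v.2) (y₂, w.2)
      rw [Prod.mk_add_mk] at h₃ h₄
      rw [max_lt_iff] at h₁ h₂
      refine max_le (h₃.trans ?_) (h₄.trans ?_) <;> linarith [h₁.1, h₁.2, h₂.1, h₂.2])
    (fun r w => by
      rw [Real.mul_iInf_of_nonneg (norm_nonneg r)]
      refine le_ciInf fun y => (ciInf_le (bddBelow_max P Q _ _) (r • y)).trans ?_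
      rw [mul_max_of_nonneg _ _ (norm_nonneg r), ← map_smul_eq_mul, ← map_smul_eq_mul]
      rfl)

lemma compSeminorm_le (P : Bridge LX LY) (Q : Bridge LY LZ) (x : LX.dom) (y : LY.dom)
    (z : LZ.dom) : compSeminorm P Q (x, z) ≤ max (P.p (x, y)) (Q.p (y, z)) :=
  ciInf_le (bddBelow_max P Q x z) y

lemma exists_of_compSeminorm_lt {P : Bridge LX LY} {Q : Bridge LY LZ} {x : LX.dom} {z : LZ.dom}
    {r : ℝ} (h : compSeminorm P Q (x, z) < r) : ∃ y : LY.dom, P.p (x, y) < r ∧ Q.p (y, z) < r := by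
  obtain ⟨y, hy⟩ := exists_lt_of_ciInf_lt h
  exact ⟨y, max_lt_iff.1 hy⟩

/-- The unit ball of the composed seminorm is closed, since the intermediate elements `y` range
over relatively compact sets. -/
lemma isClosed_compSeminorm (P : Bridge LX LY) (Q : Bridge LY LZ) :
    IsClosed {w : A × C | ∃ (h₁ : w.1 ∈ LX.dom) (h₂ : w.2 ∈ LZ.dom),
      compSeminorm P Q (⟨w.1, h₁⟩, ⟨w.2, h₂⟩) ≤ 1} := by
  refine IsSeqClosed.isClosed fun u w hu hw => ?_
  choose hx hz hxz using hu
  let s : ℕ → ℝ := fun n => 1 + 1 / ((n : ℝ) + 1)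
  have hs1 : ∀ n, 1 < s n := fun n => lt_add_of_pos_right _ (by positivity)
  have hs2 : ∀ n, s n ≤ 2 := fun n => by
    have : 1 / ((n : ℝ) + 1) ≤ 1 := by
      rw [div_le_one (by positivity)]
      linarith [n.cast_nonneg (α := ℝ)]
    simp only [s]
    linarith
  have hs0 : ∀ n, 0 < s n := fun n => zero_lt_one.trans (hs1 n)
  have hslim : Filter.Tendsto (fun n => (s n)⁻¹) Filter.atTop (𝓝 1) := by
    have h := (tendsto_one_div_add_atTop_nhds_zero_nat (𝕜 := ℝ)).const_add 1
    rw [add_zero] at h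
    simpa [s] using h.inv₀ one_ne_zero
  -- `y n` attains the infimum defining the value at `u n` up to the factor `s n`.
  choose y hPy hQy using fun n => exists_of_compSeminorm_lt ((hxz n).trans_lt (hs1 n))
  obtain ⟨R, hR0, hR⟩ := P.bounded_scaled
  obtain ⟨K, hK⟩ := (Metric.isBounded_range_of_tendsto u hw).exists_norm_le
  -- The `y n` are bounded: both `y n` and the bounded sequence `(u n).1` are close to one scalar.
  have hy : ∀ n, (2⁻¹ : ℝ) • (y n : B) ∈
      closure {b : B | ∃ h : b ∈ LY.dom, LY.L ⟨b, h⟩ ≤ 1 ∧ ‖b‖ ≤ K + 4 * R} := by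
    refine fun n => subset_closure ⟨LY.dom.smul_mem _ (y n).2, ?_, ?_⟩
    · have h := ((P.le_right _ _).trans (hPy n).le).trans (hs2 n)
      have : LY.L ((2⁻¹ : ℝ) • y n) ≤ 1 := by
        rw [map_smul_eq_mul, Real.norm_of_nonneg (by norm_num)]
        linarith
      exact this
    · obtain ⟨t, h₁, h₂⟩ := hR 2 two_pos _ _ ((hPy n).le.trans (hs2 n))
      have hun : ‖(u n).1‖ ≤ K := (norm_fst_le (u n)).trans (hK _ (mem_range_self n))
      have ht : |t| ≤ K + 2 * R := by
        rw [← X.norm_smul_one]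
        have := norm_sub_norm_le (t • (1 : A)) ((u n).1)
        rw [norm_sub_rev] at this
        linarith
      have hyn := norm_sub_norm_le (y n : B) (t • (1 : B))
      rw [Y.norm_smul_one] at hyn
      rw [norm_smul, Real.norm_of_nonneg (by norm_num)]
      linarith [norm_nonneg (y n : B)]
  obtain ⟨b, -, θ, hθ, hb⟩ := ((LY.isLipNorm.totallyBounded LY.isSelfAdjoint
    (K + 4 * R)).closure.isCompact_of_isClosed isClosed_closure).tendsto_subseq hy
  have hy' : Filter.Tendsto (fun n => (y (θ n) : B)) Filter.atTop (𝓝 ((2 : ℝ) • b)) := by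
    refine (hb.const_smul (2 : ℝ)).congr fun n => ?_
    simp [smul_smul]
  have hu' : Filter.Tendsto (fun n => u (θ n)) Filter.atTop (𝓝 w) := hw.comp hθ.tendsto_atTop
  have hs' := hslim.comp hθ.tendsto_atTop
  -- Dividing by `s n` brings the pairs into the closed unit balls before the limit is taken.
  have h₁ : (w.1, (2 : ℝ) • b) ∈ {v : A × B | ∃ (h₁ : v.1 ∈ LX.dom) (h₂ : v.2 ∈ LY.dom),
      P.p (⟨v.1, h₁⟩, ⟨v.2, h₂⟩) ≤ 1} := by
    have hlim := hs'.smul (((continuous_fst.tendsto w).comp hu').prodMk_nhds hy')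
    rw [one_smul] at hlim
    refine P.isClosed.mem_of_tendsto hlim (Filter.Eventually.of_forall fun n =>
      ⟨LX.dom.smul_mem _ (hx _), LY.dom.smul_mem _ (y _).2, ?_⟩)
    have : P.p ((s (θ n))⁻¹ • (⟨(u (θ n)).1, hx _⟩, y (θ n))) ≤ 1 := by
      rw [map_smul_eq_mul, Real.norm_of_nonneg (inv_nonneg.2 (hs0 _).le), inv_mul_le_iff₀ (hs0 _),
        mul_one]
      exact (hPy _).le
    exact this
  have h₂ : ((2 : ℝ) • b, w.2) ∈ {v : B × C | ∃ (h₁ : v.1 ∈ LY.dom) (h₂ : v.2 ∈ LZ.dom),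
      Q.p (⟨v.1, h₁⟩, ⟨v.2, h₂⟩) ≤ 1} := by
    have hlim := hs'.smul (hy'.prodMk_nhds ((continuous_snd.tendsto w).comp hu'))
    rw [one_smul] at hlim
    refine Q.isClosed.mem_of_tendsto hlim (Filter.Eventually.of_forall fun n =>
      ⟨LY.dom.smul_mem _ (y _).2, LZ.dom.smul_mem _ (hz _), ?_⟩)
    have : Q.p ((s (θ n))⁻¹ • (y (θ n), ⟨(u (θ n)).2, hz _⟩)) ≤ 1 := by
      rw [map_smul_eq_mul, Real.norm_of_nonneg (inv_nonneg.2 (hs0 _).le), inv_mul_le_iff₀ (hs0 _),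
        mul_one]
      exact (hQy _).le
    exact this
  obtain ⟨hwx, hb₁, hP⟩ := h₁
  obtain ⟨hb₂, hwz, hQ⟩ := h₂
  exact ⟨hwx, hwz, (compSeminorm_le P Q _ ⟨_, hb₁⟩ _).trans (max_le hP hQ)⟩

/-- The composition of two bridges, with seminorm `(x, z) ↦ inf_y max (p(x, y), q(y, z))`. -/
def comp (P : Bridge LX LY) (Q : Bridge LY LZ) : Bridge LX LZ where
  p := compSeminorm P Q
  map_one := le_antisymm ((compSeminorm_le P Q _ ⟨1, LY.one_mem⟩ _).trans
    (by rw [P.map_one, Q.map_one, max_self])) (apply_nonneg _ _)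
  le_left x z := le_ciInf fun y => le_max_of_le_left (P.le_left x y)
  le_right x z := le_ciInf fun y => le_max_of_le_right (Q.le_right y z)
  exists_left x r hr := by
    obtain ⟨y, hy⟩ := P.exists_left x r hr
    obtain ⟨z, hz⟩ := Q.exists_left y r ((P.le_right x y).trans_lt hy)
    exact ⟨z, (compSeminorm_le P Q x y z).trans_lt (max_lt hy hz)⟩
  exists_right z r hr := by
    obtain ⟨y, hy⟩ := Q.exists_right z r hr
    obtain ⟨x, hx⟩ := P.exists_right y r ((Q.le_left y z).trans_lt hy)
    exact ⟨x, (compSeminorm_le P Q x y z).trans_lt (max_lt hx hy)⟩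
  bounded := by
    obtain ⟨R, hR0, hR⟩ := P.bounded_scaled
    obtain ⟨S, hS0, hS⟩ := Q.bounded_scaled
    refine ⟨4 * R + 2 * S, by positivity, fun x z hxz => ?_⟩
    obtain ⟨y, hP, hQ⟩ := exists_of_compSeminorm_lt (hxz.trans_lt one_lt_two)
    obtain ⟨t, h₁, h₂⟩ := hR 2 two_pos x y hP.le
    obtain ⟨t', h₃, h₄⟩ := hS 2 two_pos y z hQ.le
    have htt : |t - t'| ≤ 2 * R + 2 * S := by
      rw [← Y.norm_smul_one, sub_smul]
      have := norm_sub_le ((y : B) - t' • (1 : B)) ((y : B) - t • (1 : B))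
      rw [sub_sub_sub_cancel_left] at this
      linarith
    refine ⟨t', ?_, h₄.trans (by linarith)⟩
    have := norm_add_le ((x : A) - t • (1 : A)) ((t - t') • (1 : A))
    rw [X.norm_smul_one, sub_smul, sub_add_sub_cancel] at this
    linarith
  isClosed := isClosed_compSeminorm P Q

lemma Within.comp {P : Bridge LX LY} {Q : Bridge LY LZ} {d e : ℝ} (hd : 0 ≤ d) (he : 0 ≤ e)
    (hP : P.Within d) (hQ : Q.Within e) : (P.comp Q).Within (d + e) := by
  have key : ∀ {n : ℕ} (φ : X.UCP n) (ψ : Y.UCP n) (χ : Z.UCP n),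
      (∀ (x : LX.dom) (y : LY.dom),
        ‖φ.1 ⟨x, LX.mem_carrier x⟩ - ψ.1 ⟨y, LY.mem_carrier y⟩‖ ≤ d * P.p (x, y)) →
      (∀ (y : LY.dom) (z : LZ.dom),
        ‖ψ.1 ⟨y, LY.mem_carrier y⟩ - χ.1 ⟨z, LZ.mem_carrier z⟩‖ ≤ e * Q.p (y, z)) →
      ∀ (x : LX.dom) (z : LZ.dom), ‖φ.1 ⟨x, LX.mem_carrier x⟩ - χ.1 ⟨z, LZ.mem_carrier z⟩‖ ≤
        (d + e) * (P.comp Q).p (x, z) := by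
    intro n φ ψ χ h₁ h₂ x z
    refine le_mul_of_forall_gt (add_nonneg hd he) fun s hs => ?_
    obtain ⟨y, hy₁, hy₂⟩ := exists_of_compSeminorm_lt hs
    calc ‖φ.1 ⟨x, LX.mem_carrier x⟩ - χ.1 ⟨z, LZ.mem_carrier z⟩‖
        ≤ ‖φ.1 ⟨x, LX.mem_carrier x⟩ - ψ.1 ⟨y, LY.mem_carrier y⟩‖ +
          ‖ψ.1 ⟨y, LY.mem_carrier y⟩ - χ.1 ⟨z, LZ.mem_carrier z⟩‖ :=
        norm_sub_le_norm_sub_add_norm_sub ..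
      _ ≤ d * s + e * s := by
        refine add_le_add ((h₁ x y).trans ?_) ((h₂ y z).trans ?_) <;> gcongr
      _ = (d + e) * s := by ring
  refine fun n hn => ⟨fun φ => ?_, fun χ => ?_⟩
  · obtain ⟨ψ, hψ⟩ := (hP n hn).1 φ
    obtain ⟨χ, hχ⟩ := (hQ n hn).1 ψ
    exact ⟨χ, key φ ψ χ hψ hχ⟩
  · obtain ⟨ψ, hψ⟩ := (hQ n hn).2 χ
    obtain ⟨φ, hφ⟩ := (hP n hn).2 ψ
    exact ⟨φ, key φ ψ χ hφ hψ⟩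

end Bridge

/-! ### Diameters -/

lemma diam_le_ofReal_iff {M : ℝ} (hM : 0 ≤ M) : LX.diam ≤ ENNReal.ofReal M ↔
    ∀ n : ℕ, 1 ≤ n → ∀ (φ ψ : X.UCP n) (x : LX.dom), LX.L x ≤ 1 →
      ‖φ.1 ⟨x, LX.mem_carrier x⟩ - ψ.1 ⟨x, LX.mem_carrier x⟩‖ ≤ M := by
  refine iSup₂_le_iff.trans (forall₂_congr fun n _ => ?_)
  let := LX.ucpMetric n
  refine Metric.ediam_le_iff.trans ⟨fun h φ ψ x hx => ?_, fun h φ _ ψ _ => ?_⟩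
  · have h' := iSup₂_le_iff.1 (h φ (mem_univ _) ψ (mem_univ _)) ⟨x, LX.mem_carrier x⟩ ⟨x.2, hx⟩
    rwa [← ofReal_norm, ENNReal.ofReal_le_ofReal_iff hM] at h'
  · refine iSup₂_le fun x hx => ?_
    rw [← ofReal_norm, ENNReal.ofReal_le_ofReal_iff hM]
    exact h φ ψ ⟨x, hx.1⟩ hx.2

/-- The diameter of a Lip-normed operator system is finite. -/
lemma exists_diam_le (LX : LipNorm X) : ∃ M : ℝ, 0 ≤ M ∧ LX.diam ≤ ENNReal.ofReal M := by
  obtain ⟨R, hR0, hR⟩ := LX.isLipNorm.exists_norm_sub_le LX.isSelfAdjoint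
  refine ⟨R + R, by positivity, (diam_le_ofReal_iff (by positivity)).2 fun n _ φ ψ x hx => ?_⟩
  obtain ⟨t, ht⟩ := hR x hx
  have hsa : IsSelfAdjoint ((x : A) - t • 1) :=
    (LX.isSelfAdjoint x x.2).sub (isSelfAdjoint_smul_one t)
  have key : ∀ φ : X.UCP n, ‖φ.1 ⟨x, LX.mem_carrier x⟩ - t • 1‖ ≤ R := fun φ => by
    have := (φ.norm_le (x := ⟨x, LX.mem_carrier x⟩ - ⟨t • 1, X.smul_one_mem t⟩) hsa).trans ht
    rwa [map_sub, φ.map_smul_one] at this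
  rw [← sub_sub_sub_cancel_right _ _ (t • (1 : Matrix (Fin n) (Fin n) ℂ))]
  exact (norm_sub_le _ _).trans (add_le_add (key φ) (key ψ))

lemma Bridge.Within.diam_le {P : Bridge LX LY} {d M : ℝ} (hd : 0 ≤ d) (hP : P.Within d)
    (hM : 0 ≤ M) (h : LX.diam ≤ ENNReal.ofReal M) : LY.diam ≤ ENNReal.ofReal (M + 2 * d) := by
  rw [diam_le_ofReal_iff hM] at h
  refine (diam_le_ofReal_iff (by positivity)).2 fun n hn ψ₁ ψ₂ y hy => ?_
  obtain ⟨φ₁, h₁⟩ := (hP n hn).2 ψ₁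
  obtain ⟨φ₂, h₂⟩ := (hP n hn).2 ψ₂
  rw [← mul_one (M + 2 * d)]
  refine le_mul_of_forall_gt (by positivity) fun s hs => ?_
  have hs0 : 0 < s := zero_lt_one.trans hs
  obtain ⟨x, hx⟩ := P.exists_right y s (hy.trans_lt hs)
  have hLx := (P.le_left x y).trans hx.le
  have h₃ := h n hn φ₁ φ₂ (s⁻¹ • x) (by
    rwa [map_smul_eq_mul, Real.norm_of_nonneg (inv_nonneg.2 hs0.le), inv_mul_le_iff₀ hs0, mul_one])
  have h₄ : ∀ φ : X.UCP n, φ.1 ⟨(s⁻¹ • x : LX.dom), LX.mem_carrier _⟩ =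
      s⁻¹ • φ.1 ⟨x, LX.mem_carrier x⟩ := fun φ => by
    rw [← Complex.coe_smul, ← map_smul]
    rfl
  rw [h₄, h₄, ← smul_sub, norm_smul, Real.norm_of_nonneg (inv_nonneg.2 hs0.le),
    inv_mul_le_iff₀ hs0] at h₃
  have h₅ := (h₁ x y).trans (mul_le_mul_of_nonneg_left hx.le hd)
  have h₆ := (h₂ x y).trans (mul_le_mul_of_nonneg_left hx.le hd)
  rw [norm_sub_rev] at h₅
  calc _ ≤ ‖ψ₁.1 ⟨y, LY.mem_carrier y⟩ - φ₁.1 ⟨x, LX.mem_carrier x⟩‖ +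
        ‖φ₁.1 ⟨x, LX.mem_carrier x⟩ - φ₂.1 ⟨x, LX.mem_carrier x⟩‖ +
        ‖φ₂.1 ⟨x, LX.mem_carrier x⟩ - ψ₂.1 ⟨y, LY.mem_carrier y⟩‖ := by
        refine (norm_sub_le_norm_sub_add_norm_sub _ (φ₂.1 ⟨x, LX.mem_carrier x⟩) _).trans ?_
        gcongr
        exact norm_sub_le_norm_sub_add_norm_sub ..
    _ ≤ (M + 2 * d) * s := by linarith

end LipNorm

/-! ### Positive matrices over matrix algebras -/

section MatrixPositivity

open scoped Matrix ComplexOrder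

variable {ι κ : Type*} [Fintype ι] [DecidableEq ι] [Fintype κ] [DecidableEq κ]

open scoped MatrixOrder in
lemma Matrix.isPos_iff_posSemidef {x : Matrix ι ι ℂ} : IsPos x ↔ x.PosSemidef := by
  rw [← Matrix.nonneg_iff_posSemidef, CStarAlgebra.nonneg_iff_eq_star_mul_self]
  rfl

/-- Positivity in `Mₘ(Mₖ)` is positive semidefiniteness of the matrix obtained by removing the
inner brackets. -/
lemma Matrix.isPos_iff_posSemidef_comp {x : Matrix ι ι (Matrix κ κ ℂ)} :
    IsPos x ↔ (Matrix.comp ι ι κ κ ℂ x).PosSemidef := by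
  rw [← Matrix.isPos_iff_posSemidef]
  have hstar : ∀ b : Matrix ι ι (Matrix κ κ ℂ),
      Matrix.compRingEquiv ι κ ℂ (star b) = star (Matrix.compRingEquiv ι κ ℂ b) := fun _ => rfl
  constructor
  · rintro ⟨b, rfl⟩
    exact ⟨Matrix.compRingEquiv ι κ ℂ b, by rw [← hstar, ← map_mul]; rfl⟩
  · rintro ⟨b, hb⟩
    refine ⟨(Matrix.compRingEquiv ι κ ℂ).symm b, (Matrix.compRingEquiv ι κ ℂ).injective ?_⟩
    rw [map_mul, hstar, RingEquiv.apply_symm_apply]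
    exact hb

/-- Over `ℂ`, nonnegativity of the quadratic form implies hermitian symmetry. -/
lemma Matrix.posSemidef_of_forall {M : Matrix ι ι ℂ}
    (h : ∀ v : ι → ℂ, 0 ≤ star v ⬝ᵥ (M *ᵥ v)) : M.PosSemidef := by
  rw [← Matrix.isPositive_toEuclideanLin_iff, LinearMap.isPositive_iff_complex]
  intro x
  have hx : inner ℂ (M.toEuclideanLin x) x = star (star x.ofLp ⬝ᵥ (M *ᵥ x.ofLp)) := by
    rw [← inner_conj_symm, EuclideanSpace.inner_eq_star_dotProduct, Matrix.ofLp_toLpLin,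
      Matrix.toLin'_apply, dotProduct_comm]
    rfl
  have h₀ := Complex.nonneg_iff.1 (h x.ofLp)
  rw [hx]
  refine ⟨Complex.ext ?_ ?_, ?_⟩
  · simp
  · simpa using h₀.2.symm
  · simpa using h₀.1

lemma Matrix.star_dotProduct_mulVec_eq_sum {ι : Type*} [Fintype ι] (M : Matrix ι ι ℂ) (v : ι → ℂ) :
    star v ⬝ᵥ (M *ᵥ v) = ∑ i, ∑ j, star (v i) * v j * M i j := by
  simp only [dotProduct, Matrix.mulVec, Finset.mul_sum, Pi.star_apply]
  exact Finset.sum_congr rfl fun i _ => Finset.sum_congr rfl fun j _ => by ring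

end MatrixPositivity

/-! ### Arveson's extension theorem for operator subsystems of matrix algebras -/

namespace OperatorSystem

open scoped Matrix ComplexOrder

variable {A : Type*} [CStarAlgebra A]

lemma UCP.map_star {X : OperatorSystem A} {n : ℕ} (φ : X.UCP n) (x : X.carrier) :
    φ.1 ⟨star (x : A), X.star_mem _ x.2⟩ = star (φ.1 x) := by
  set y : X.carrier := ⟨star (x : A), X.star_mem _ x.2⟩ with hy
  have h₁ : star (φ.1 (x + y)) = φ.1 (x + y) :=
    φ.isSelfAdjoint (x := x + y) (IsSelfAdjoint.add_star_self (x : A))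
  have h₂ : star (φ.1 (Complex.I • (x - y))) = φ.1 (Complex.I • (x - y)) := by
    refine φ.isSelfAdjoint (x := Complex.I • (x - y)) ?_
    simp only [hy, IsSelfAdjoint, Submodule.coe_smul, Submodule.coe_sub, star_smul, star_sub,
      star_star, Complex.star_def, Complex.conj_I, neg_smul, ← smul_neg, neg_sub]
  rw [map_add, star_add] at h₁
  rw [map_smul, star_smul, map_sub, star_sub, Complex.star_def, Complex.conj_I, neg_smul,
    ← smul_neg, neg_sub] at h₂
  have h₃ := smul_right_injective _ Complex.I_ne_zero h₂
  have h₄ : (2 : ℂ) • φ.1 y = (2 : ℂ) • star (φ.1 x) := by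
    rw [two_smul, two_smul]
    calc φ.1 y + φ.1 y = (φ.1 x + φ.1 y) - (φ.1 x - φ.1 y) := by abel
      _ = (star (φ.1 x) + star (φ.1 y)) - (star (φ.1 y) - star (φ.1 x)) := by rw [h₁, ← h₃]
      _ = _ := by abel
  exact smul_right_injective _ two_ne_zero h₄

/-- The whole algebra as an operator system. -/
def full (h : (1 : A) ≠ 0) : OperatorSystem A where
  carrier := ⊤
  isClosed := isClosed_univ
  one_mem := trivial
  star_mem _ _ := trivial
  one_ne_zero := h

/-- The restriction of a u.c.p. map on the whole algebra to an operator system. -/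
def UCP.restrict {h : (1 : A) ≠ 0} {n : ℕ} (Φ : (full h).UCP n) (X : OperatorSystem A) : X.UCP n :=
  ⟨Φ.1 ∘ₗ Submodule.inclusion le_top, Φ.2.1, fun m x hx =>
    Φ.2.2 m (x.map (Submodule.inclusion le_top)) hx⟩

variable {k n : ℕ} {Y : OperatorSystem (Matrix (Fin k) (Fin k) ℂ)}

/-- The matrices in `Mₙ(Mₖ)`, with brackets removed, all of whose entries belong to `Y`. -/
def blockSubmodule (Y : OperatorSystem (Matrix (Fin k) (Fin k) ℂ)) (n : ℕ) :
    Submodule ℝ (Matrix (Fin n × Fin k) (Fin n × Fin k) ℂ) where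
  carrier := {z | ∀ i j, z.submatrix (Prod.mk i) (Prod.mk j) ∈ Y.carrier}
  add_mem' ha hb i j := Y.carrier.add_mem (ha i j) (hb i j)
  zero_mem' _ _ := Y.carrier.zero_mem
  smul_mem' r _ ha i j := Y.real_smul_mem (ha i j) r

/-- The functional `z ↦ ∑ᵢⱼ φ(zᵢⱼ)ᵢⱼ` on `Mₙ(Y)`. -/
def blockSum (φ : Y.UCP n) (z : Matrix (Fin n × Fin k) (Fin n × Fin k) ℂ)
    (hz : z ∈ blockSubmodule Y n) : ℂ :=
  ∑ i, ∑ j, φ.1 ⟨z.submatrix (Prod.mk i) (Prod.mk j), hz i j⟩ i j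

/-- Its real part, as a real-linear functional. -/
def blockFunctional (φ : Y.UCP n) : blockSubmodule Y n →ₗ[ℝ] ℝ where
  toFun z := (blockSum φ z z.2).re
  map_add' z w := by
    rw [← Complex.add_re, blockSum, blockSum, blockSum]
    simp only [← Finset.sum_add_distrib, ← Matrix.add_apply, ← map_add]
    rfl
  map_smul' r z := by
    have : ∀ i j, φ.1 ⟨(r • z : blockSubmodule Y n).1.submatrix (Prod.mk i) (Prod.mk j),
        (r • z).2 i j⟩ = (r : ℂ) • φ.1 ⟨z.1.submatrix (Prod.mk i) (Prod.mk j), z.2 i j⟩ := by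
      intro i j
      rw [← map_smul]
      rfl
    simp only [blockSum, this, Matrix.smul_apply, ← Finset.smul_sum]
    simp

lemma blockSubmodule_conjTranspose {z : Matrix (Fin n × Fin k) (Fin n × Fin k) ℂ}
    (hz : z ∈ blockSubmodule Y n) : zᴴ ∈ blockSubmodule Y n := fun i j =>
  Y.star_mem _ (hz j i)

lemma blockSum_conjTranspose (φ : Y.UCP n) {z : Matrix (Fin n × Fin k) (Fin n × Fin k) ℂ}
    (hz : z ∈ blockSubmodule Y n) :
    blockSum φ zᴴ (blockSubmodule_conjTranspose hz) = star (blockSum φ z hz) := by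
  simp only [blockSum, star_sum]
  rw [Finset.sum_comm]
  refine Finset.sum_congr rfl fun i _ => Finset.sum_congr rfl fun j _ => ?_
  have := φ.map_star ⟨z.submatrix (Prod.mk i) (Prod.mk j), hz i j⟩
  exact congrFun (congrFun this j) i

/-- Complete positivity makes `z ↦ ∑ᵢⱼ φ(zᵢⱼ)ᵢⱼ` a positive functional: it is the vector
functional of `φₙ(z)` at `∑ᵢ eᵢ ⊗ eᵢ`. -/
lemma blockSum_nonneg (φ : Y.UCP n) {z : Matrix (Fin n × Fin k) (Fin n × Fin k) ℂ}
    (hz : z ∈ blockSubmodule Y n) (hpos : z.PosSemidef) : 0 ≤ blockSum φ z hz := by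
  have h := φ.2.2 n (Matrix.of fun i j => ⟨z.submatrix (Prod.mk i) (Prod.mk j), hz i j⟩)
    (Matrix.isPos_iff_posSemidef_comp.2 hpos)
  have h' := (Matrix.isPos_iff_posSemidef_comp.1 h).dotProduct_mulVec_nonneg
    fun ia => if ia.1 = ia.2 then 1 else 0
  rw [Matrix.star_dotProduct_mulVec_eq_sum] at h'
  simpa [Fintype.sum_prod_type, blockSum, Matrix.comp_apply] using h'

/-- The cone of matrices with positive semidefinite real part. -/
def accretiveCone (ι : Type*) [Fintype ι] : PointedCone ℝ (Matrix ι ι ℂ) where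
  carrier := {z | (z + zᴴ).PosSemidef}
  add_mem' {a b} ha hb := by
    have := Matrix.PosSemidef.add ha hb
    rwa [add_add_add_comm, ← Matrix.conjTranspose_add] at this
  zero_mem' := by simpa using Matrix.PosSemidef.zero
  smul_mem' c a ha := by
    have h : (c • a + (c • a)ᴴ) = (c : ℝ) • (a + aᴴ) := by
      change (c : ℝ) • a + ((c : ℝ) • a)ᴴ = _
      rw [Matrix.conjTranspose_smul, star_trivial (c : ℝ), smul_add]
    change (c • a + (c • a)ᴴ).PosSemidef
    rw [h]
    exact Matrix.PosSemidef.smul ha c.2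

lemma exists_smul_one_add_mem_accretiveCone {ι : Type*} [Fintype ι] [DecidableEq ι]
    (z : Matrix ι ι ℂ) : ∃ r : ℝ, r • (1 : Matrix ι ι ℂ) + z ∈ accretiveCone ι := by
  have h := Matrix.isPos_iff_posSemidef.1
    (IsSelfAdjoint.add_star_self z).isPos_norm_smul_one_add
  refine ⟨‖z + star z‖ / 2, ?_⟩
  change (_ + _ᴴ : Matrix ι ι ℂ).PosSemidef
  convert h using 1
  rw [Matrix.conjTranspose_add, Matrix.conjTranspose_smul, Matrix.conjTranspose_one,
    star_trivial (_ / 2 : ℝ), add_add_add_comm, ← add_smul, add_halves]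
  rfl

/-- A positive complex functional on `Mₙ(Mₖ)` extending `z ↦ ∑ᵢⱼ φ(zᵢⱼ)ᵢⱼ`, obtained from the
M. Riesz extension theorem. -/
lemma exists_positive_extension (φ : Y.UCP n) :
    ∃ F : Matrix (Fin n × Fin k) (Fin n × Fin k) ℂ →ₗ[ℂ] ℂ,
      (∀ z (hz : z ∈ blockSubmodule Y n), F z = blockSum φ z hz) ∧
      ∀ z : Matrix (Fin n × Fin k) (Fin n × Fin k) ℂ, z.PosSemidef → 0 ≤ F z := by
  have hpos : ∀ z : blockSubmodule Y n, (z : Matrix _ _ ℂ) ∈ accretiveCone (Fin n × Fin k) →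
      0 ≤ blockFunctional φ z := fun z hz => by
    have h := Complex.nonneg_iff.1 (blockSum_nonneg φ
      (add_mem z.2 (blockSubmodule_conjTranspose z.2)) hz)
    have h₁ := (blockFunctional φ).map_add z ⟨_, blockSubmodule_conjTranspose z.2⟩
    have h₂ : blockFunctional φ ⟨_, blockSubmodule_conjTranspose z.2⟩ = blockFunctional φ z := by
      change (blockSum φ _ _).re = (blockSum φ _ _).re
      rw [blockSum_conjTranspose φ z.2]
      simp
    rw [h₂] at h₁
    have h₃ : 0 ≤ blockFunctional φ z + blockFunctional φ z := h.1.trans_eq h₁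
    change 0 ≤ blockFunctional φ z
    linarith
  have hdense : ∀ z : Matrix (Fin n × Fin k) (Fin n × Fin k) ℂ,
      ∃ x : blockSubmodule Y n, (x : Matrix _ _ ℂ) + z ∈ accretiveCone (Fin n × Fin k) :=
    fun z => by
    obtain ⟨r, hr⟩ := exists_smul_one_add_mem_accretiveCone z
    refine ⟨⟨r • 1, (blockSubmodule Y n).smul_mem r fun i j => ?_⟩, hr⟩
    by_cases hij : i = j
    · subst hij
      convert Y.one_mem
      ext a b
      simp [Matrix.one_apply]
    · convert Y.carrier.zero_mem
      ext a b
      simp [hij]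
  obtain ⟨g, hg, hg0⟩ := riesz_extension (accretiveCone (Fin n × Fin k))
    ⟨blockSubmodule Y n, blockFunctional φ⟩ hpos hdense
  refine ⟨Module.Dual.extendRCLike g, fun z hz => ?_, fun z hz => ?_⟩
  · have hI : Complex.I • z ∈ blockSubmodule Y n := fun i j => Y.carrier.smul_mem _ (hz i j)
    have h₁ : g z = (blockSum φ z hz).re := hg ⟨z, hz⟩
    have h₂ : g (Complex.I • z) = (Complex.I * blockSum φ z hz).re := by
      refine (hg ⟨_, hI⟩).trans ?_
      change (blockSum φ _ hI).re = _
      congr 1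
      simp only [blockSum, Finset.mul_sum]
      refine Finset.sum_congr rfl fun i _ => Finset.sum_congr rfl fun j _ => ?_
      have := φ.1.map_smul Complex.I ⟨z.submatrix (Prod.mk i) (Prod.mk j), hz i j⟩
      exact congrFun (congrFun this i) j
    apply Complex.ext
    · refine (Module.Dual.re_extendRCLike_apply (𝕜 := ℂ) g z).trans h₁
    · refine (Module.Dual.im_extendRCLike_apply (𝕜 := ℂ) g z).trans ?_
      refine (congrArg Neg.neg h₂).trans ?_
      simp
  · have h₁ : 0 ≤ g z := hg0 z (hz.add hz.conjTranspose)
    -- `i z` and `-i z` both belong to the cone, so `g` vanishes at `i z` and `F z` is real.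
    have hI : ∀ c : ℂ, star c = -c → 0 ≤ g (c • z) := fun c hc => hg0 _ (by
      change (c • z + (c • z)ᴴ).PosSemidef
      rw [Matrix.conjTranspose_smul, hc, hz.isHermitian.eq, neg_smul, add_neg_cancel]
      exact Matrix.PosSemidef.zero)
    have h₂ := hI Complex.I (by simp)
    have h₃ := hI (-Complex.I) (by simp)
    rw [neg_smul, map_neg] at h₃
    rw [Complex.nonneg_iff]
    constructor
    · exact h₁.trans_eq (Module.Dual.re_extendRCLike_apply (𝕜 := ℂ) g z).symm
    · refine Eq.trans ?_ (Module.Dual.im_extendRCLike_apply (𝕜 := ℂ) g z).symm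
      have : g (Complex.I • z) = 0 := by linarith
      exact (neg_eq_zero.2 this).symm

open scoped Kronecker in
/-- Arveson's extension theorem: a u.c.p. map from an operator subsystem of `Mₖ` to `Mₙ` extends to
a u.c.p. map on `Mₖ`. -/
theorem UCP.exists_extension (φ : Y.UCP n) :
    ∃ Φ : (full Y.one_ne_zero).UCP n, ∀ y : Y.carrier, Φ.1 ⟨y, trivial⟩ = φ.1 y := by
  obtain ⟨F, hF, hF0⟩ := exists_positive_extension φ
  -- `Φ(a)ᵢⱼ = F(eᵢⱼ ⊗ a)`
  let Φ : (full Y.one_ne_zero).carrier →ₗ[ℂ] Matrix (Fin n) (Fin n) ℂ :=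
    { toFun := fun a => Matrix.of fun i j => F (Matrix.single i j (1 : ℂ) ⊗ₖ a.1)
      map_add' := fun a b => by
        ext i j
        simp [Matrix.kronecker_add]
      map_smul' := fun c a => by
        ext i j
        simp [Matrix.kronecker_smul] }
  have hext : ∀ y : Y.carrier, Φ ⟨y, trivial⟩ = φ.1 y := by
    intro y
    ext i j
    have hblock : ∀ p q, (Matrix.single i j (1 : ℂ) ⊗ₖ (y : Matrix (Fin k) (Fin k) ℂ)).submatrix
        (Prod.mk p) (Prod.mk q) = Matrix.single i j (1 : ℂ) p q • (y : Matrix (Fin k) (Fin k) ℂ) :=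
      fun p q => rfl
    have hmem : Matrix.single i j (1 : ℂ) ⊗ₖ (y : Matrix (Fin k) (Fin k) ℂ) ∈ blockSubmodule Y n :=
      fun p q => by
        rw [hblock]
        exact Y.carrier.smul_mem _ y.2
    refine (hF _ hmem).trans ?_
    have hφ : ∀ p q, φ.1 ⟨_, hmem p q⟩ = Matrix.single i j (1 : ℂ) p q • φ.1 y := fun p q => by
      rw [← map_smul]
      rfl
    simp only [blockSum, hφ, Matrix.smul_apply, Matrix.single_apply]
    simp [ite_and]
  refine ⟨⟨Φ, (hext ⟨1, Y.one_mem⟩).trans φ.map_one, fun m x hx => ?_⟩, hext⟩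
  rw [Matrix.isPos_iff_posSemidef_comp] at hx ⊢
  refine Matrix.posSemidef_of_forall fun v => ?_
  -- The quadratic form of `(Φ(x p q))` at `v` is the value of `F` at `V⋆ x V`.
  let V : Matrix (Fin m × Fin k) (Fin n × Fin k) ℂ :=
    (Matrix.of fun p i => v (p, i)) ⊗ₖ (1 : Matrix (Fin k) (Fin k) ℂ)
  have hW := hF0 _ (hx.conjTranspose_mul_mul_same V)
  refine hW.trans_eq ?_
  rw [Matrix.star_dotProduct_mulVec_eq_sum]
  have hsum : Vᴴ * Matrix.comp (Fin m) (Fin m) (Fin k) (Fin k) ℂ (x.map fun a => a.1) * V =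
      ∑ pi : Fin m × Fin n, ∑ qj : Fin m × Fin n,
        (star (v pi) * v qj) • (Matrix.single pi.2 qj.2 (1 : ℂ) ⊗ₖ (x pi.1 qj.1).1) := by
    ext ⟨i, a⟩ ⟨j, b⟩
    simp only [Matrix.mul_apply, Matrix.sum_apply, Fintype.sum_prod_type, Matrix.smul_apply,
      Matrix.conjTranspose_apply, V, Matrix.kronecker_apply, Matrix.of_apply, Matrix.one_apply,
      Matrix.comp_apply, Matrix.map_apply, Matrix.single_apply, Finset.sum_mul]
    simp only [ite_and, apply_ite star, mul_ite, mul_one, mul_zero, star_zero, ite_mul, zero_mul,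
      one_mul, smul_eq_mul]
    simp only [Finset.sum_ite_eq', Finset.sum_ite_irrel, Finset.sum_const_zero,
      Finset.mem_univ, if_true]
    refine Finset.sum_comm.trans
      (Finset.sum_congr rfl fun p _ => Finset.sum_congr rfl fun q _ => ?_)
    ring
  rw [hsum]
  simp only [map_sum, map_smul]
  rfl

end OperatorSystem

/-! ### Lip-normed operator subsystems of matrix algebras -/

namespace OperatorSystem

open scoped Matrix ComplexOrder

variable {k : ℕ} {Y : OperatorSystem (Matrix (Fin k) (Fin k) ℂ)}

/-- The vector state `a ↦ ⟨a ξ, ξ⟩`, as a u.c.p. map to `M₁`. -/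
def vectorState (Y : OperatorSystem (Matrix (Fin k) (Fin k) ℂ)) (ξ : Fin k → ℂ)
    (hξ : star ξ ⬝ᵥ ξ = 1) : Y.UCP 1 :=
  ⟨{ toFun := fun a => (star ξ ⬝ᵥ (a.1 *ᵥ ξ)) • (1 : Matrix (Fin 1) (Fin 1) ℂ)
     map_add' := fun a b => by
      simp [Matrix.add_mulVec, dotProduct_add, add_smul]
     map_smul' := fun c a => by
      simp [Matrix.smul_mulVec, dotProduct_smul, smul_smul] },
    by simp [hξ], fun m x hx => by
      rw [Matrix.isPos_iff_posSemidef_comp] at hx ⊢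
      refine Matrix.posSemidef_of_forall fun v => ?_
      -- the quadratic form of `x` at `v ⊗ ξ`
      refine (hx.dotProduct_mulVec_nonneg fun pa => v (pa.1, 0) * ξ pa.2).trans_eq ?_
      rw [Matrix.star_dotProduct_mulVec_eq_sum, Matrix.star_dotProduct_mulVec_eq_sum]
      simp only [Fintype.sum_prod_type, Matrix.comp_apply, Matrix.map_apply, LinearMap.coe_mk,
        AddHom.coe_mk, Matrix.star_dotProduct_mulVec_eq_sum, Matrix.smul_apply, Finset.univ_unique,
        Finset.sum_singleton, Fin.default_eq_zero, Matrix.one_apply_eq, smul_eq_mul, mul_one,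
        Finset.mul_sum, star_mul']
      refine Finset.sum_congr rfl fun p _ => ?_
      rw [Finset.sum_comm]
      refine Finset.sum_congr rfl fun q _ => Finset.sum_congr rfl fun a _ =>
        Finset.sum_congr rfl fun b _ => ?_
      ring⟩

lemma norm_vectorState_sub (ξ η : Fin k → ℂ) (hξ : star ξ ⬝ᵥ ξ = 1) (hη : star η ⬝ᵥ η = 1)
    (y : Y.carrier) : ‖(Y.vectorState ξ hξ).1 y - (Y.vectorState η hη).1 y‖ =
      ‖star ξ ⬝ᵥ (y.1 *ᵥ ξ) - star η ⬝ᵥ (y.1 *ᵥ η)‖ := by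
  change ‖(star ξ ⬝ᵥ (y.1 *ᵥ ξ)) • (1 : Matrix (Fin 1) (Fin 1) ℂ) -
    (star η ⬝ᵥ (y.1 *ᵥ η)) • (1 : Matrix (Fin 1) (Fin 1) ℂ)‖ = _
  rw [← sub_smul, norm_smul, CStarRing.norm_one, mul_one]

end OperatorSystem

section NumericalRange

open scoped Matrix ComplexOrder

/-- The norm of a hermitian matrix is bounded by its numerical radius. -/
lemma Matrix.IsHermitian.norm_le_of_forall {ι : Type*} [Fintype ι] [DecidableEq ι]
    {h : Matrix ι ι ℂ} (hh : h.IsHermitian) {R : ℝ} (hR : 0 ≤ R)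
    (hle : ∀ ξ : ι → ℂ, star ξ ⬝ᵥ ξ = 1 → ‖star ξ ⬝ᵥ (h *ᵥ ξ)‖ ≤ R) : ‖h‖ ≤ R := by
  have key : ∀ g : Matrix ι ι ℂ, g.IsHermitian →
      (∀ ξ : ι → ℂ, star ξ ⬝ᵥ ξ = 1 → ‖star ξ ⬝ᵥ (g *ᵥ ξ)‖ ≤ R) →
      IsPos (R • (1 : Matrix ι ι ℂ) + g) := by
    intro g hg hgle
    rw [Matrix.isPos_iff_posSemidef]
    refine Matrix.PosSemidef.of_dotProduct_mulVec_nonneg ?_ fun v => ?_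
    · exact (isSelfAdjoint_smul_one (A := Matrix ι ι ℂ) R).add hg
    obtain ⟨N, hN0, hN⟩ : ∃ N : ℝ, 0 ≤ N ∧ star v ⬝ᵥ v = N := by
      have h0 := Complex.nonneg_iff.1 (dotProduct_star_self_nonneg (star v))
      rw [star_star, dotProduct_comm] at h0
      exact ⟨_, h0.1, Complex.ext (by simp) (by simpa using h0.2.symm)⟩
    have hq : ‖star v ⬝ᵥ (g *ᵥ v)‖ ≤ N * R := by
      rcases hN0.eq_or_lt with h0 | hpos
      · rw [← h0, Complex.ofReal_zero, dotProduct_star_self_eq_zero] at hN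
        simp [hN, ← h0]
      · set c : ℝ := (√N)⁻¹ with hc
        have hcc : c * c * N = 1 := by
          rw [hc, ← mul_inv, Real.mul_self_sqrt hN0, inv_mul_cancel₀ hpos.ne']
        have := hgle ((c : ℂ) • v) (by
          rw [star_smul, smul_dotProduct, dotProduct_smul, hN, Complex.star_def,
            Complex.conj_ofReal, smul_eq_mul, smul_eq_mul, ← mul_assoc]
          exact_mod_cast hcc)
        rw [star_smul, smul_dotProduct, Matrix.mulVec_smul, dotProduct_smul, Complex.star_def,
          Complex.conj_ofReal, smul_smul, norm_smul, ← Complex.ofReal_mul, Complex.norm_real,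
          Real.norm_of_nonneg (mul_self_nonneg c)] at this
        calc ‖star v ⬝ᵥ (g *ᵥ v)‖ = (c * c * N) * ‖star v ⬝ᵥ (g *ᵥ v)‖ := by rw [hcc, one_mul]
          _ = N * (c * c * ‖star v ⬝ᵥ (g *ᵥ v)‖) := by ring
          _ ≤ N * R := by gcongr
    have him := hg.im_star_dotProduct_mulVec_self v
    rw [Matrix.add_mulVec, dotProduct_add, Matrix.smul_mulVec, Matrix.one_mulVec,
      dotProduct_smul, hN]
    refine Complex.nonneg_iff.2 ⟨?_, ?_⟩
    · have := (Complex.abs_re_le_norm (star v ⬝ᵥ (g *ᵥ v))).trans hq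
      simp only [Complex.add_re, Complex.real_smul, Complex.re_ofReal_mul, Complex.ofReal_re]
      linarith [neg_abs_le (star v ⬝ᵥ (g *ᵥ v)).re]
    · have : (star v ⬝ᵥ (g *ᵥ v)).im = 0 := him
      simp [this]
  refine norm_le_of_isPos hh hR ?_ (key h hh hle)
  rw [sub_eq_add_neg]
  refine key _ hh.neg fun ξ hξ => ?_
  rw [Matrix.neg_mulVec, dotProduct_neg, norm_neg]
  exact hle ξ hξ

end NumericalRange

namespace LipNorm

open scoped Matrix in
/-- For an operator subsystem of `Mₖ` the vector states show that elements of Lip-norm at most `1`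
are at distance at most the diameter from the scalars. -/
lemma exists_norm_sub_smul_one_le {k : ℕ} {Y : OperatorSystem (Matrix (Fin k) (Fin k) ℂ)}
    {LY : LipNorm Y} {R : ℝ} (hR : 0 ≤ R) (hdiam : LY.diam ≤ ENNReal.ofReal R) (y : LY.dom)
    (hy : LY.L y ≤ 1) : ∃ t : ℝ, ‖(y : Matrix (Fin k) (Fin k) ℂ) - t • 1‖ ≤ R := by
  have hk : Nonempty (Fin k) := by
    by_contra hE
    rw [not_nonempty_iff] at hE
    exact Y.one_ne_zero (Subsingleton.elim _ _)
  obtain ⟨i⟩ := hk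
  have hi : star (Pi.single i 1 : Fin k → ℂ) ⬝ᵥ Pi.single i 1 = 1 := by simp
  have hyH : (y : Matrix (Fin k) (Fin k) ℂ).IsHermitian := LY.isSelfAdjoint y y.2
  set η : Fin k → ℂ := Pi.single i 1
  set t : ℝ := (star η ⬝ᵥ (y.1 *ᵥ η)).re with ht
  have ht' : star η ⬝ᵥ (y.1 *ᵥ η) = t :=
    Complex.ext (by simp [ht]) (by simpa using hyH.im_star_dotProduct_mulVec_self η)
  refine ⟨t, Matrix.IsHermitian.norm_le_of_forall
    (IsSelfAdjoint.sub hyH (isSelfAdjoint_smul_one t)) hR fun ξ hξ => ?_⟩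
  have := (diam_le_ofReal_iff hR).1 hdiam 1 le_rfl (Y.vectorState ξ hξ) (Y.vectorState η hi) y hy
  rw [OperatorSystem.norm_vectorState_sub, ht'] at this
  rw [Matrix.sub_mulVec, dotProduct_sub, Matrix.smul_mulVec, Matrix.one_mulVec, dotProduct_smul, hξ]
  simpa using this

section MaxBridge

variable {A : Type*} [CStarAlgebra A] {X Y : OperatorSystem A} {LX : LipNorm X} {LY : LipNorm Y}

/-- If the unit balls of `L_X` and `L_Y`, inside the same C⋆-algebra, lie in the closed
`δ`-neighbourhoods of each other, then `max (L_X(x), L_Y(y), ‖x - y‖ / δ)` defines a bridge. -/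
def maxBridge {δ : ℝ} (hδ : 0 < δ)
    (h₁ : ∀ x : LX.dom, LX.L x ≤ 1 → ∃ y : LY.dom, LY.L y ≤ 1 ∧ ‖(x : A) - y‖ ≤ δ)
    (h₂ : ∀ y : LY.dom, LY.L y ≤ 1 → ∃ x : LX.dom, LX.L x ≤ 1 ∧ ‖(x : A) - y‖ ≤ δ) :
    Bridge LX LY :=
  have scale : ∀ {x : LX.dom} {y : LY.dom} {s : ℝ}, 0 < s → ‖((s⁻¹ • x : LX.dom) : A) - y‖ ≤ δ →
      δ⁻¹ * ‖(x : A) - (s • y : LY.dom)‖ ≤ s := fun {x y s} hs h => by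
    have h' : (x : A) - (s • y : LY.dom) = s • (((s⁻¹ • x : LX.dom) : A) - y) := by
      simp [smul_sub, smul_smul, hs.ne']
    rw [h', norm_smul, Real.norm_of_nonneg hs.le, inv_mul_le_iff₀ hδ, mul_comm δ]
    gcongr
  have scale' : ∀ {x : LX.dom} {y : LY.dom} {s : ℝ}, 0 < s → ‖(x : A) - (s⁻¹ • y : LY.dom)‖ ≤ δ →
      δ⁻¹ * ‖((s • x : LX.dom) : A) - y‖ ≤ s := fun {x y s} hs h => by
    have h' : ((s • x : LX.dom) : A) - y = s • ((x : A) - (s⁻¹ • y : LY.dom)) := by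
      simp [smul_sub, smul_smul, hs.ne']
    rw [h', norm_smul, Real.norm_of_nonneg hs.le, inv_mul_le_iff₀ hδ, mul_comm δ]
    gcongr
  { p := (LX.L.comp (LinearMap.fst ℝ _ _) ⊔ LY.L.comp (LinearMap.snd ℝ _ _)) ⊔
      (normSeminorm ℝ A).comp (δ⁻¹ •
        (LX.dom.subtype ∘ₗ LinearMap.fst ℝ _ _ - LY.dom.subtype ∘ₗ LinearMap.snd ℝ _ _))
    map_one := by
      have hx := LX.L_smul_one 1
      have hy := LY.L_smul_one 1
      simp only [one_smul] at hx hy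
      simp [hx, hy]
    le_left := fun x y => le_max_of_le_left (le_max_left _ _)
    le_right := fun x y => le_max_of_le_left (le_max_right _ _)
    exists_left := fun x r hr => by
      obtain ⟨s, hs, hsr⟩ := exists_between hr
      have hs0 : 0 < s := (apply_nonneg _ _).trans_lt hs
      obtain ⟨y, hy, hxy⟩ := h₁ (s⁻¹ • x) (by
        rw [map_smul_eq_mul, Real.norm_of_nonneg (inv_nonneg.2 hs0.le), inv_mul_le_iff₀ hs0,
          mul_one]
        exact hs.le)
      refine ⟨s • y, lt_of_le_of_lt (max_le (max_le hs.le ?_) ?_) hsr⟩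
      · change LY.L (s • y) ≤ s
        rw [map_smul_eq_mul, Real.norm_of_nonneg hs0.le]
        exact mul_le_of_le_one_right hs0.le hy
      · change ‖δ⁻¹ • ((x : A) - (s • y : LY.dom))‖ ≤ s
        rw [norm_smul, Real.norm_of_nonneg (inv_nonneg.2 hδ.le)]
        exact scale hs0 hxy
    exists_right := fun y r hr => by
      obtain ⟨s, hs, hsr⟩ := exists_between hr
      have hs0 : 0 < s := (apply_nonneg _ _).trans_lt hs
      obtain ⟨x, hx, hxy⟩ := h₂ (s⁻¹ • y) (by
        rw [map_smul_eq_mul, Real.norm_of_nonneg (inv_nonneg.2 hs0.le), inv_mul_le_iff₀ hs0,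
          mul_one]
        exact hs.le)
      refine ⟨s • x, lt_of_le_of_lt (max_le (max_le ?_ hs.le) ?_) hsr⟩
      · change LX.L (s • x) ≤ s
        rw [map_smul_eq_mul, Real.norm_of_nonneg hs0.le]
        exact mul_le_of_le_one_right hs0.le hx
      · change ‖δ⁻¹ • (((s • x : LX.dom) : A) - y)‖ ≤ s
        rw [norm_smul, Real.norm_of_nonneg (inv_nonneg.2 hδ.le)]
        exact scale' hs0 hxy
    bounded := by
      obtain ⟨R, hR0, hR⟩ := LX.isLipNorm.exists_norm_sub_le LX.isSelfAdjoint
      refine ⟨R + δ, by positivity, fun x y h => ?_⟩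
      obtain ⟨h₁₂, h₃⟩ := max_le_iff.1 h
      obtain ⟨t, ht⟩ := hR x (max_le_iff.1 h₁₂).1
      have h₄ : ‖δ⁻¹ • ((x : A) - y)‖ ≤ 1 := h₃
      rw [norm_smul, Real.norm_of_nonneg (inv_nonneg.2 hδ.le), inv_mul_le_iff₀ hδ, mul_one] at h₄
      refine ⟨t, ht.trans (by linarith), ?_⟩
      have h₅ := norm_sub_le ((x : A) - t • 1) ((x : A) - y)
      rw [sub_sub_sub_cancel_left] at h₅
      linarith
    isClosed := by
      have : {z : A × A | ∃ (h₁ : z.1 ∈ LX.dom) (h₂ : z.2 ∈ LY.dom),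
          ((LX.L.comp (LinearMap.fst ℝ LX.dom LY.dom) ⊔ LY.L.comp (LinearMap.snd ℝ _ _)) ⊔
            (normSeminorm ℝ A).comp (δ⁻¹ • (LX.dom.subtype ∘ₗ LinearMap.fst ℝ _ _ -
              LY.dom.subtype ∘ₗ LinearMap.snd ℝ _ _))) (⟨z.1, h₁⟩, ⟨z.2, h₂⟩) ≤ 1} =
          (Prod.fst ⁻¹' {a : A | ∃ h : a ∈ LX.dom, LX.L ⟨a, h⟩ ≤ 1} ∩
            Prod.snd ⁻¹' {a : A | ∃ h : a ∈ LY.dom, LY.L ⟨a, h⟩ ≤ 1}) ∩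
          {z : A × A | ‖δ⁻¹ • (z.1 - z.2)‖ ≤ 1} := by
        ext z
        constructor
        · rintro ⟨h₁, h₂, h⟩
          obtain ⟨h₁₂, h₃⟩ := max_le_iff.1 h
          exact ⟨⟨⟨h₁, (max_le_iff.1 h₁₂).1⟩, ⟨h₂, (max_le_iff.1 h₁₂).2⟩⟩, h₃⟩
        · rintro ⟨⟨⟨h₁, hx⟩, ⟨h₂, hy⟩⟩, h₃⟩
          exact ⟨h₁, h₂, max_le (max_le hx hy) h₃⟩
      rw [this]
      exact ((LX.isClosed.preimage continuous_fst).inter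
        (LY.isClosed.preimage continuous_snd)).inter
        (isClosed_le (by fun_prop) continuous_const) }

lemma norm_sub_le_maxBridge {δ : ℝ} (hδ : 0 < δ)
    (h₁ : ∀ x : LX.dom, LX.L x ≤ 1 → ∃ y : LY.dom, LY.L y ≤ 1 ∧ ‖(x : A) - y‖ ≤ δ)
    (h₂ : ∀ y : LY.dom, LY.L y ≤ 1 → ∃ x : LX.dom, LX.L x ≤ 1 ∧ ‖(x : A) - y‖ ≤ δ)
    (x : LX.dom) (y : LY.dom) : ‖(x : A) - y‖ ≤ δ * (maxBridge hδ h₁ h₂).p (x, y) := by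
  have h : ‖δ⁻¹ • ((x : A) - y)‖ ≤ (maxBridge hδ h₁ h₂).p (x, y) := le_max_right _ _
  rwa [norm_smul, Real.norm_of_nonneg (inv_nonneg.2 hδ.le), inv_mul_le_iff₀ hδ] at h

end MaxBridge

/-- For operator subsystems of `Mₖ`, Arveson's theorem provides for each `φ ∈ UCPₙ(X)` a u.c.p. map
on `Mₖ` whose restriction to `Y` is close to `φ`. -/
lemma within_maxBridge {k : ℕ} {X Y : OperatorSystem (Matrix (Fin k) (Fin k) ℂ)} {LX : LipNorm X}
    {LY : LipNorm Y} {δ : ℝ} (hδ : 0 < δ)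
    (h₁ : ∀ x : LX.dom, LX.L x ≤ 1 → ∃ y : LY.dom, LY.L y ≤ 1 ∧
      ‖(x : Matrix (Fin k) (Fin k) ℂ) - y‖ ≤ δ)
    (h₂ : ∀ y : LY.dom, LY.L y ≤ 1 → ∃ x : LX.dom, LX.L x ≤ 1 ∧
      ‖(x : Matrix (Fin k) (Fin k) ℂ) - y‖ ≤ δ) : (maxBridge hδ h₁ h₂).Within δ := by
  have key : ∀ {n : ℕ} (Φ : (OperatorSystem.full X.one_ne_zero).UCP n) (x : LX.dom) (y : LY.dom),
      ‖Φ.1 ⟨x, trivial⟩ - Φ.1 ⟨y, trivial⟩‖ ≤ δ * (maxBridge hδ h₁ h₂).p (x, y) := by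
    intro n Φ x y
    refine le_trans ?_ (norm_sub_le_maxBridge hδ h₁ h₂ x y)
    rw [← map_sub]
    exact Φ.norm_le ((LX.isSelfAdjoint x x.2).sub (LY.isSelfAdjoint y y.2))
  refine fun n _ => ⟨fun φ => ?_, fun ψ => ?_⟩
  · obtain ⟨Φ, hΦ⟩ := φ.exists_extension
    refine ⟨Φ.restrict Y, fun x y => ?_⟩
    rw [← hΦ]
    exact key Φ x y
  · obtain ⟨Φ, hΦ⟩ := ψ.exists_extension
    refine ⟨Φ.restrict X, fun x y => ?_⟩
    rw [← hΦ]
    exact key Φ x y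

end LipNorm

/-! ### Finite approximation and total boundedness -/

namespace LipNorm

variable {A : Type*} [CStarAlgebra A] {X : OperatorSystem A} {LX : LipNorm X}

lemma exists_of_afn_le {ε : ℝ} {K : ℕ} (h : LX.afn ε ≤ K) :
    ∃ k ≤ K, ∃ (Y : OperatorSystem (Matrix (Fin k) (Fin k) ℂ)) (LY : LipNorm Y),
      LX.completeDist LY ≤ ENNReal.ofReal ε := by
  have hne : {m : ℕ∞ | ∃ k : ℕ, m = k ∧ ∃ (Y : OperatorSystem (Matrix (Fin k) (Fin k) ℂ))
      (LY : LipNorm Y), LX.completeDist LY ≤ ENNReal.ofReal ε}.Nonempty := by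
    by_contra hE
    rw [not_nonempty_iff_eq_empty] at hE
    rw [afn, hE, sInf_empty, top_le_iff] at h
    exact ENat.natCast_ne_top K h
  obtain ⟨k, hk, hY⟩ := csInf_mem hne
  refine ⟨k, ?_, hY⟩
  rw [afn, hk] at h
  exact_mod_cast h

lemma afn_le {ε : ℝ} {k : ℕ} {Y : OperatorSystem (Matrix (Fin k) (Fin k) ℂ)} {LY : LipNorm Y}
    (h : LX.completeDist LY ≤ ENNReal.ofReal ε) : LX.afn ε ≤ k :=
  sInf_le ⟨k, rfl, Y, LY, h⟩

end LipNorm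

namespace LipNormedOperatorSystem

open LipNorm

/-- Given a finite net of the ball of radius `R` in `Mₖ`, a Lip-normed operator subsystem of `Mₖ` of
diameter at most `R` is determined, up to a small complete distance, by the points of the net which
are close to the unit ball of its Lip-norm. -/
lemma exists_finite_of_matrix_approx {k : ℕ} {R η δ : ℝ} (hR : 0 ≤ R) (hη : 0 ≤ η) (hδ : 0 < δ)
    (C : Set LipNormedOperatorSystem.{u})
    (hC : ∀ S ∈ C, ∃ (Y : OperatorSystem (Matrix (Fin k) (Fin k) ℂ)) (LY : LipNorm Y)
      (P : Bridge S.L LY), P.Within η ∧ LY.diam ≤ ENNReal.ofReal R) :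
    ∃ G ⊆ C, G.Finite ∧ ∀ S ∈ C, ∃ T ∈ G,
      S.L.completeDist T.L ≤ ENNReal.ofReal (η + (δ + η)) := by
  choose Y LY P hP hdiam using fun S : C => hC S S.2
  have hcpt : TotallyBounded (Metric.closedBall (0 : Matrix (Fin k) (Fin k) ℂ) R) := by
    have : ProperSpace (Matrix (Fin k) (Fin k) ℂ) := FiniteDimensional.proper ℂ _
    exact (isCompact_closedBall _ _).totallyBounded
  obtain ⟨N, hN, hcov⟩ := Metric.totallyBounded_iff.1 hcpt (δ / 2) (half_pos hδ)
  -- The points of the net which are `δ / 2`-close to the unit ball of the approximation of `S`.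
  let sig : C → Set (Matrix (Fin k) (Fin k) ℂ) := fun S =>
    {p ∈ N | ∃ y : (LY S).dom, (LY S).L y ≤ 1 ∧ ‖(y : Matrix (Fin k) (Fin k) ℂ) - p‖ ≤ δ / 2}
  have hfin : (range sig).Finite := by
    refine hN.powerset.subset ?_
    rintro _ ⟨S, rfl⟩
    exact sep_subset _ _
  have happrox : ∀ S T : C, sig S = sig T → ∀ x : (LY S).dom, (LY S).L x ≤ 1 →
      ∃ y : (LY T).dom, (LY T).L y ≤ 1 ∧ ‖(x : Matrix (Fin k) (Fin k) ℂ) - y‖ ≤ δ := by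
    intro S T hST x hx
    obtain ⟨t, ht⟩ := exists_norm_sub_smul_one_le hR (hdiam S) x hx
    obtain ⟨b, hb, hbL⟩ := (LY S).exists_eq_add_smul_one x (-t)
    rw [neg_smul, ← sub_eq_add_neg] at hb
    rw [← hb] at ht
    obtain ⟨p, hpN, hp⟩ := mem_iUnion₂.1 (hcov (mem_closedBall_zero_iff.2 ht))
    rw [Metric.mem_ball, dist_eq_norm] at hp
    have hmem : p ∈ sig S := ⟨hpN, b, hbL.trans hx, hp.le⟩
    rw [hST] at hmem
    obtain ⟨-, c, hc, hcp⟩ := hmem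
    obtain ⟨y, hy, hyL⟩ := (LY T).exists_eq_add_smul_one c t
    refine ⟨y, hyL.trans hc, ?_⟩
    have hxy : (x : Matrix (Fin k) (Fin k) ℂ) - y = (b - p) - (c - p) := by
      rw [hb, hy]
      abel
    rw [hxy]
    exact (norm_sub_le _ _).trans (by linarith)
  have : Finite (range sig) := hfin
  choose pick hpick using fun b : range sig => b.2
  refine ⟨range fun b => (pick b : LipNormedOperatorSystem.{u}), ?_, finite_range _, fun S hS => ?_⟩
  · rintro _ ⟨b, rfl⟩
    exact (pick b).2
  obtain ⟨T, hTG, hsig⟩ : ∃ T ∈ range pick, sig T = sig ⟨S, hS⟩ :=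
    ⟨_, mem_range_self ⟨sig ⟨S, hS⟩, mem_range_self _⟩, hpick _⟩
  refine ⟨T, ?_, ?_⟩
  · obtain ⟨b, rfl⟩ := hTG
    exact ⟨b, rfl⟩
  have hW := within_maxBridge hδ (happrox ⟨S, hS⟩ T hsig.symm) (fun y hy => by
    obtain ⟨x, hx, hxy⟩ := happrox T ⟨S, hS⟩ hsig y hy
    exact ⟨x, hx, by rwa [norm_sub_rev]⟩)
  exact ((hP ⟨S, hS⟩).comp hη (by positivity) (hW.comp hδ.le hη (hP T).symm)).completeDist_le
    (by positivity)

lemma IsTotallyBounded.exists_diam_le {C : Set LipNormedOperatorSystem.{u}}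
    (h : IsTotallyBounded C) : ∃ M : ℝ, 0 < M ∧ ∀ S ∈ C, S.L.diam ≤ ENNReal.ofReal M := by
  obtain ⟨G, -, hG, hcov⟩ := h 1 one_pos
  choose M hM0 hM using fun S : LipNormedOperatorSystem.{u} => S.L.exists_diam_le
  obtain ⟨K, hK⟩ := (hG.image M).bddAbove
  refine ⟨max K 0 + 2 * 1, by positivity, fun S hS => ?_⟩
  obtain ⟨T, hT, hST⟩ := hcov S hS
  obtain ⟨P, hP⟩ := exists_within_of_completeDist_lt hST
  exact hP.symm.diam_le zero_le_one (by positivity) ((hM T).trans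
    (ENNReal.ofReal_le_ofReal ((hK (mem_image_of_mem M hT)).trans (le_max_left _ _))))

lemma IsTotallyBounded.exists_afn_le {C : Set LipNormedOperatorSystem.{u}}
    (hC : C ⊆ FinitelyApproximable) (h : IsTotallyBounded C) {ε : ℝ} (hε : 0 < ε) :
    ∃ K : ℕ, ∀ S ∈ C, S.L.afn ε ≤ K := by
  obtain ⟨G, hGC, hG, hcov⟩ := h (ε / 3) (by positivity)
  have hbdd : BddAbove ((fun T : LipNormedOperatorSystem.{u} => (T.L.afn (ε / 3)).toNat) '' G) :=
    (hG.image _).bddAbove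
  obtain ⟨K, hK⟩ := hbdd
  refine ⟨K, fun S hS => ?_⟩
  obtain ⟨T, hT, hST⟩ := hcov S hS
  have hafn : T.L.afn (ε / 3) ≤ K := by
    rw [← ENat.natCast_toNat (hC (hGC hT) (ε / 3) (by positivity)).ne]
    exact_mod_cast hK (mem_image_of_mem _ hT)
  obtain ⟨k, hk, Y, LY, hY⟩ := exists_of_afn_le hafn
  obtain ⟨P, hP⟩ := exists_within_of_completeDist_lt hST
  obtain ⟨Q, hQ⟩ := exists_within_of_completeDist_lt (d := 2 * (ε / 3)) (hY.trans_lt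
    ((ENNReal.ofReal_lt_ofReal_iff (by positivity)).2 (by linarith)))
  have hPQ := (hP.comp (by positivity) (by positivity) hQ).completeDist_le (by positivity)
  rw [show ε / 3 + 2 * (ε / 3) = ε by ring] at hPQ
  exact (afn_le hPQ).trans (by exact_mod_cast hk)

lemma isTotallyBounded_of_bounds {C : Set LipNormedOperatorSystem.{u}} {M : ℝ} (hM : 0 ≤ M)
    (hdiam : ∀ S ∈ C, S.L.diam ≤ ENNReal.ofReal M)
    (hafn : ∀ ε : ℝ, 0 < ε → ∃ K : ℕ, ∀ S ∈ C, S.L.afn ε ≤ K) : IsTotallyBounded C := by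
  intro ε hε
  -- The approximation at `ε / 8` yields strict inequality at `ε / 4`, and three steps of `ε / 4`
  -- lead from `S` to its matrix approximation, to that of `T`, and to `T`.
  obtain ⟨K, hK⟩ := hafn (ε / 8) (by positivity)
  let D : ℕ → Set LipNormedOperatorSystem.{u} := fun k =>
    {S ∈ C | ∃ (Y : OperatorSystem (Matrix (Fin k) (Fin k) ℂ)) (LY : LipNorm Y)
      (P : Bridge S.L LY), P.Within (ε / 4) ∧ LY.diam ≤ ENNReal.ofReal (M + 2 * (ε / 4))}
  choose G hGD hG hcov using fun k => exists_finite_of_matrix_approx (k := k)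
    (R := M + 2 * (ε / 4)) (η := ε / 4) (δ := ε / 4) (by positivity) (by positivity) (by positivity)
    (D k) fun S hS => hS.2
  refine ⟨⋃ k ∈ Iic K, G k, iUnion₂_subset fun k _ => (hGD k).trans (sep_subset _ _),
    (finite_Iic K).biUnion fun k _ => hG k, fun S hS => ?_⟩
  obtain ⟨k, hk, Y, LY, hY⟩ := exists_of_afn_le (hK S hS)
  obtain ⟨P, hP⟩ := exists_within_of_completeDist_lt (d := ε / 4) (hY.trans_lt
    ((ENNReal.ofReal_lt_ofReal_iff (by positivity)).2 (by linarith)))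
  have hSD : S ∈ D k := ⟨hS, Y, LY, P, hP, hP.diam_le (by positivity) hM (hdiam S hS)⟩
  obtain ⟨T, hT, hST⟩ := hcov k S hSD
  exact ⟨T, mem_biUnion (mem_Iic.2 hk) hT, hST.trans_lt
    ((ENNReal.ofReal_lt_ofReal_iff hε).2 (by linarith))⟩

end LipNormedOperatorSystem

end

theorem mainTheorem4 (C : Set LipNormedOperatorSystem.{u})
    (hC : C ⊆ LipNormedOperatorSystem.FinitelyApproximable) :
    LipNormedOperatorSystem.IsTotallyBounded C ↔
      (∃ M : ℝ, 0 < M ∧ ∀ S ∈ C, S.L.diam ≤ ENNReal.ofReal M) ∧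
      (∃ F : Set.Ioi (0 : ℝ) → Set.Ioi (0 : ℝ), ∀ S ∈ C, ∀ ε : Set.Ioi (0 : ℝ),
        (S.L.afn (ε : ℝ) : ENNReal) ≤ ENNReal.ofReal (F ε : ℝ)) := by
  have hcast : ∀ K : ℕ, ((K : ℕ∞) : ENNReal) = ENNReal.ofReal (K : ℝ) := fun K => by simp
  constructor
  · intro h
    choose K hK using fun ε : Set.Ioi (0 : ℝ) => h.exists_afn_le hC ε.2
    refine ⟨h.exists_diam_le, fun ε => ⟨K ε + 1, Set.mem_Ioi.2 (by positivity)⟩,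
      fun S hS ε => ?_⟩
    refine (ENat.toENNReal_le.2 (hK ε S hS)).trans ?_
    rw [hcast]
    exact ENNReal.ofReal_le_ofReal (by simp)
  · rintro ⟨⟨M, hM, hdiam⟩, F, hF⟩
    refine LipNormedOperatorSystem.isTotallyBounded_of_bounds hM.le hdiam fun ε hε =>
      ⟨⌈(F ⟨ε, hε⟩ : ℝ)⌉₊, fun S hS => ENat.toENNReal_le.1 ((hF S hS ⟨ε, hε⟩).trans ?_)⟩
    rw [hcast]
    exact ENNReal.ofReal_le_ofReal (Nat.le_ceil _)
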